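/- Let $f:O\to\mathbb R^n$ be a smooth map on an open set $O\subset\mathbb R^n\times\mathbb R^m$ with $\operatorname{rank}\partial_{(x,u)}f=n$ on $O$, and let $(x_0,u_0)\in O$ be an equilibrium, $f(x_0,u_0)=x_0$, of the discrete-time system $x^+=f(x,u)$. A codistribution of dimension $k$ is a field of $k$-dimensional subspaces of the cotangent spaces that is locally spanned by $k$ smooth, pointwise linearly independent 1-forms; it is invariant with respect to a distribution $D$ if $L_v\omega$ belongs to it for all 1-forms $\omega$ in it and all vector fields $v\in D$. Let $P_1=\operatorname{span}\{dx^1,\dots,dx^n\}$ and let $P_2^+$ be the smallest field of subspaces on $O$ that contains $P_1\cap\operatorname{span}\{df\}$ and is invariant with respect to the annihilator $\operatorname{span}\{df\}^\perp$. Assume that $P_1\cap\operatorname{span}\{df\}$ and $P_2^+$ are codistributions (of constant dimension) on $O$. Let $P_2=\delta^{-1}(P_2^+)$ be the backward-shift: if on an open neighbourhood $W\subset O$ of $(x_0,u_0)$ the codistribution $P_2^+$ is spanned by forms $\omega^j_i(f(x,u))\,df^i$ with $\omega^j_i$ smooth on $f(W)$, then $P_2$ is spanned by the forms $\omega^j_i(x)\,dx^i$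 at the points $(x,u)$ with $x\in f(W)$. Then such a $W$ exists, and for every such $W$ and the resulting $P_2$: 1. $P_1$ and $P_2$ have constant dimensions, and the system can be transformed, locally around $(x_0,u_0)$, by a state and input transformation $(\bar x_1,\bar x_2)=\Phi_x(x)$, $(\bar u_1,\bar u_2)=\Phi_u(x,u)$ (smooth local changes of coordinates) into the triangular form $$\bar x_2^+=f_2(\bar x_2,\bar x_1,\bar u_2),\qquad \bar x_1^+=f_1(\bar x_2,\bar x_1,\bar u_2,\bar u_1)$$ with smooth $f_1,f_2$, $\dim\bar x_1\ge 1$ and $\operatorname{rank}\partial_{\bar u_1}f_1=\dim\bar x_1$, if and only if $\dim P_2<\dim P_1$. 2. If $\dim P_2<\dim P_1$, there exists a state transformation $(\bar x_1,\bar x_2)=\Phi_x(x)$ around $x_0$ with $\dim\bar x_2=\dim P_2$ and $\dim\bar x_1=\dim P_1-\dim P_2$ which straightens out $P_2$, i.e. $P_2=\operatorname{span}\{d\bar x_2\}$ near $(x_0,u_0)$; and every such state transformation can be completed by an input transformation to a transformation into the above triangular form. -/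

import Mathlib

open scoped ContDiff Topology

/-! ### 1-forms, distributions and codistributions on (open subsets of) a real vector space

Vector fields and 1-forms on an open set `O` are represented by functions on the whole space;
only their values on `O` matter. A (co)distribution is a field of linear subspaces. -/

section Geometry

variable {E : Type*} [NormedAddCommGroup E] [NormedSpace ℝ E]

/-- The Lie derivative of the 1-form `η` along the vector field `v`:
`(L_v η)_i = v^k ∂_k η_i + η_k ∂_i v^k`. -/
noncomputable def lieDerivForm (v : E → E) (η : E → (E →L[ℝ] ℝ)) : E → (E →L[ℝ] ℝ) :=
  fun p => fderiv ℝ η p (v p) + (η p).comp (fderiv ℝ v p)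

/-- The codistribution `span {dg¹, …, dgᵏ}` of the differentials of the components of `g`. -/
noncomputable def dspan {k : ℕ} (g : E → (Fin k → ℝ)) : E → Submodule ℝ (E →L[ℝ] ℝ) :=
  fun p => Submodule.span ℝ (Set.range fun i : Fin k => fderiv ℝ (fun q => g q i) p)

/-- The annihilator `P^⊥` of a codistribution `P`. -/
def annihilator (P : E → Submodule ℝ (E →L[ℝ] ℝ)) : E → Submodule ℝ E := fun p =>
  { carrier := {w | ∀ η ∈ P p, η w = 0}
    add_mem' := fun {a b} ha hb η hη => by simp [ha η hη, hb η hη]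
    zero_mem' := fun η _ => map_zero η
    smul_mem' := fun c w hw η hη => by simp [hw η hη] }

/-- `P` is, on the open set `O`, a smooth codistribution of constant dimension `k`: around every
point of `O` it is spanned by `k` pointwise linearly independent smooth 1-forms. -/
def IsCodistributionOn (O : Set E) (k : ℕ) (P : E → Submodule ℝ (E →L[ℝ] ℝ)) : Prop :=
  ∀ p ∈ O, ∃ V : Set E, IsOpen V ∧ p ∈ V ∧ V ⊆ O ∧
    ∃ η : Fin k → E → (E →L[ℝ] ℝ), (∀ i, ContDiffOn ℝ ∞ (η i) V) ∧
      ∀ q ∈ V, LinearIndependent ℝ (fun i => η i q) ∧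
        P q = Submodule.span ℝ (Set.range fun i => η i q)

/-- `Q` is invariant with respect to the distribution `D` on `O`: `L_v η ∈ Q` for all smooth
1-forms `η ∈ Q` and smooth vector fields `v ∈ D` on `O`. -/
def IsInvariantOn (O : Set E) (D : E → Submodule ℝ E) (Q : E → Submodule ℝ (E →L[ℝ] ℝ)) : Prop :=
  ∀ (v : E → E) (η : E → (E →L[ℝ] ℝ)), ContDiffOn ℝ ∞ v O → ContDiffOn ℝ ∞ η O →
    (∀ p ∈ O, v p ∈ D p) → (∀ p ∈ O, η p ∈ Q p) → ∀ p ∈ O, lieDerivForm v η p ∈ Q p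

/-- The smallest field of subspaces which contains `P` and is invariant with respect to `D`
on `O`. If it is smooth of constant dimension, it is the smallest invariant codistribution
containing `P`. -/
def smallestInvariant (O : Set E) (D : E → Submodule ℝ E) (P : E → Submodule ℝ (E →L[ℝ] ℝ)) :
    E → Submodule ℝ (E →L[ℝ] ℝ) :=
  sInf {Q | (∀ p ∈ O, P p ≤ Q p) ∧ IsInvariantOn O D Q}

theorem mem_smallestInvariant {O : Set E} {D : E → Submodule ℝ E}
    {P : E → Submodule ℝ (E →L[ℝ] ℝ)} {p : E} {ζ : E →L[ℝ] ℝ} :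
    ζ ∈ smallestInvariant O D P p ↔
      ∀ Q : E → Submodule ℝ (E →L[ℝ] ℝ),
        (∀ p ∈ O, P p ≤ Q p) → IsInvariantOn O D Q → ζ ∈ Q p := by
  simp [smallestInvariant, sInf_apply, Submodule.mem_iInf]

/-- `smallestInvariant` indeed contains `P`, is invariant, and is smallest with this property. -/
theorem smallestInvariant_isLeast (O : Set E) (D : E → Submodule ℝ E)
    (P : E → Submodule ℝ (E →L[ℝ] ℝ)) :
    IsLeast {Q | (∀ p ∈ O, P p ≤ Q p) ∧ IsInvariantOn O D Q} (smallestInvariant O D P) := by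
  refine ⟨⟨fun p hp _ hζ => mem_smallestInvariant.2 fun Q hQ _ => hQ p hp hζ, ?_⟩,
    fun Q hQ => sInf_le hQ⟩
  intro v η hv hη hvD hηQ p hp
  exact mem_smallestInvariant.2 fun Q hQ hI => hI v η hv hη hvD
    (fun q hq => mem_smallestInvariant.1 (hηQ q hq) Q hQ hI) p hp

/-- `Φ` is a local diffeomorphism (a local coordinate transformation) around `x₀`. -/
def IsDiffeoAround {F : Type*} [NormedAddCommGroup F] [NormedSpace ℝ F]
    (Φ : OpenPartialHomeomorph E F) (x₀ : E) : Prop :=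
  x₀ ∈ Φ.source ∧ ContDiffOn ℝ ∞ Φ Φ.source ∧ ContDiffOn ℝ ∞ Φ.symm Φ.target

end Geometry

/-! ### Discrete-time systems `x⁺ = f(x, u)` -/

section System

variable {n m : ℕ}

/-- A smooth system `x⁺ = f(x, u)` on the open set `O` of the `(x, u)`-space satisfying the
submersivity condition `rank ∂_{(x,u)} f = n`, considered around its equilibrium `(x₀, u₀)`. -/
structure IsSystemAround (f : (Fin n → ℝ) × (Fin m → ℝ) → (Fin n → ℝ))
    (O : Set ((Fin n → ℝ) × (Fin m → ℝ))) (x₀ : Fin n → ℝ) (u₀ : Fin m → ℝ) : Prop where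
  isOpen : IsOpen O
  mem : (x₀, u₀) ∈ O
  smooth : ContDiffOn ℝ ∞ f O
  submersive : ∀ p ∈ O, Module.finrank ℝ (fderiv ℝ f p).range = n
  equilibrium : f (x₀, u₀) = x₀

/-- `P₁ = span {dx}` on the `(x, u)`-space. -/
noncomputable def P1 (n m : ℕ) : (Fin n → ℝ) × (Fin m → ℝ) →
    Submodule ℝ ((Fin n → ℝ) × (Fin m → ℝ) →L[ℝ] ℝ) :=
  dspan (Prod.fst : (Fin n → ℝ) × (Fin m → ℝ) → (Fin n → ℝ))

/-- `P₂⁺`: the smallest codistribution on `O` that contains `P₁ ∩ span {df}` and is invariant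
with respect to `span {df}^⊥`. -/
noncomputable def P2plus (f : (Fin n → ℝ) × (Fin m → ℝ) → (Fin n → ℝ))
    (O : Set ((Fin n → ℝ) × (Fin m → ℝ))) : (Fin n → ℝ) × (Fin m → ℝ) →
    Submodule ℝ ((Fin n → ℝ) × (Fin m → ℝ) →L[ℝ] ℝ) :=
  smallestInvariant O (annihilator (dspan f)) (P1 n m ⊓ dspan f)

/-- The points `(x, u)` with `x ∈ f(W)`: the domain of the backward-shift of a codistribution
given on `W`. -/
def shiftDomain (f : (Fin n → ℝ) × (Fin m → ℝ) → (Fin n → ℝ))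
    (W : Set ((Fin n → ℝ) × (Fin m → ℝ))) : Set ((Fin n → ℝ) × (Fin m → ℝ)) :=
  {p | p.1 ∈ f '' W}

/-- `R = δ⁻¹(Q)`, with `Q` given on `W`: there are 1-forms `ηʲ = ηʲ_i(x) dx^i`, smooth on `f(W)`,
such that `Q` is spanned on `W` by the forms `ηʲ_i(f(x,u)) df^i`, and `R` is spanned by the forms
`ηʲ_i(x) dx^i` (regarded as forms on the `(x, u)`-space). -/
def IsBackwardShiftOn (f : (Fin n → ℝ) × (Fin m → ℝ) → (Fin n → ℝ))
    (W : Set ((Fin n → ℝ) × (Fin m → ℝ)))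
    (Q R : (Fin n → ℝ) × (Fin m → ℝ) →
      Submodule ℝ ((Fin n → ℝ) × (Fin m → ℝ) →L[ℝ] ℝ)) : Prop :=
  ∃ (k : ℕ) (η : Fin k → (Fin n → ℝ) → ((Fin n → ℝ) →L[ℝ] ℝ)),
    (∀ j, ContDiffOn ℝ ∞ (η j) (f '' W)) ∧
    (∀ p ∈ W, Q p = Submodule.span ℝ
      (Set.range fun j => (η j (f p)).comp (fderiv ℝ f p))) ∧
    (∀ p ∈ shiftDomain f W, R p = Submodule.span ℝ
      (Set.range fun j => (η j p.1).comp
        (ContinuousLinearMap.fst ℝ (Fin n → ℝ) (Fin m → ℝ))))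

/-- `P₂` is (a representative, near `(x₀, u₀)`, of) the second codistribution of the sequence:
on some open neighbourhood `W ⊆ O` of `(x₀, u₀)` it is the backward-shift of `P₂⁺`. -/
def IsP2 (f : (Fin n → ℝ) × (Fin m → ℝ) → (Fin n → ℝ))
    (O : Set ((Fin n → ℝ) × (Fin m → ℝ))) (x₀ : Fin n → ℝ) (u₀ : Fin m → ℝ)
    (W : Set ((Fin n → ℝ) × (Fin m → ℝ)))
    (P₂ : (Fin n → ℝ) × (Fin m → ℝ) →
      Submodule ℝ ((Fin n → ℝ) × (Fin m → ℝ) →L[ℝ] ℝ)) : Prop :=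
  IsOpen W ∧ (x₀, u₀) ∈ W ∧ W ⊆ O ∧ IsBackwardShiftOn f W (P2plus f O) P₂

/-- The state transformation `(x̄₁, x̄₂) = Φ(x)` and the input transformation
`(ū₁, ū₂) = Φ_u(x, u)`, combined to `Ψ(x, u) = ((x̄₁, x̄₂), (ū₁, ū₂))`, transform the system
around `(x₀, u₀)` into
`x̄₂⁺ = f₂(x̄₂, x̄₁, ū₂)`, `x̄₁⁺ = f₁(x̄₂, x̄₁, ū₂, ū₁)`
with `dim x̄₁ ≥ 1` and `rank ∂_{ū₁} f₁ = dim x̄₁`. -/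
structure IsTriangularForm (f : (Fin n → ℝ) × (Fin m → ℝ) → (Fin n → ℝ))
    (O : Set ((Fin n → ℝ) × (Fin m → ℝ))) (x₀ : Fin n → ℝ) (u₀ : Fin m → ℝ)
    {n₁ n₂ m₁ m₂ : ℕ}
    (Φ : OpenPartialHomeomorph (Fin n → ℝ) ((Fin n₁ → ℝ) × (Fin n₂ → ℝ)))
    (Ψ : OpenPartialHomeomorph ((Fin n → ℝ) × (Fin m → ℝ))
      (((Fin n₁ → ℝ) × (Fin n₂ → ℝ)) × ((Fin m₁ → ℝ) × (Fin m₂ → ℝ)))) : Prop where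
  state_diffeo : IsDiffeoAround Φ x₀
  diffeo : IsDiffeoAround Ψ (x₀, u₀)
  domain : ∀ p ∈ Ψ.source, p ∈ O ∧ p.1 ∈ Φ.source ∧ f p ∈ Φ.source
  state : ∀ p ∈ Ψ.source, (Ψ p).1 = Φ p.1
  dim_pos : 1 ≤ n₁
  form : ∃ (f₂ : (Fin n₂ → ℝ) × (Fin n₁ → ℝ) × (Fin m₂ → ℝ) → (Fin n₂ → ℝ))
      (f₁ : (Fin n₂ → ℝ) × (Fin n₁ → ℝ) × (Fin m₂ → ℝ) × (Fin m₁ → ℝ) → (Fin n₁ → ℝ)),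
    ContDiffOn ℝ ∞ f₂ ((fun q => (q.1.2, q.1.1, q.2.2)) '' Ψ.target) ∧
    ContDiffOn ℝ ∞ f₁ ((fun q => (q.1.2, q.1.1, q.2.2, q.2.1)) '' Ψ.target) ∧
    (∀ p ∈ Ψ.source,
      (Φ (f p)).2 = f₂ ((Ψ p).1.2, (Ψ p).1.1, (Ψ p).2.2) ∧
      (Φ (f p)).1 = f₁ ((Ψ p).1.2, (Ψ p).1.1, (Ψ p).2.2, (Ψ p).2.1)) ∧
    (∀ q ∈ Ψ.target, Module.finrank ℝ
      (fderiv ℝ (fun w => f₁ (q.1.2, q.1.1, q.2.2, w)) q.2.1).range = n₁)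

/-- The system can be transformed around `(x₀, u₀)` into the triangular form. -/
def HasTriangularForm (f : (Fin n → ℝ) × (Fin m → ℝ) → (Fin n → ℝ))
    (O : Set ((Fin n → ℝ) × (Fin m → ℝ))) (x₀ : Fin n → ℝ) (u₀ : Fin m → ℝ) : Prop :=
  ∃ (n₁ n₂ m₁ m₂ : ℕ)
    (Φ : OpenPartialHomeomorph (Fin n → ℝ) ((Fin n₁ → ℝ) × (Fin n₂ → ℝ)))
    (Ψ : OpenPartialHomeomorph ((Fin n → ℝ) × (Fin m → ℝ))
      (((Fin n₁ → ℝ) × (Fin n₂ → ℝ)) × ((Fin m₁ → ℝ) × (Fin m₂ → ℝ)))),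
    IsTriangularForm f O x₀ u₀ Φ Ψ

/-- The state transformation `(x̄₁, x̄₂) = Φ(x)` around `x₀` straightens out the codistribution
`P` near `(x₀, u₀)`: `P = span {dx̄₂}`. -/
def StraightensOut {n₁ n₂ : ℕ}
    (Φ : OpenPartialHomeomorph (Fin n → ℝ) ((Fin n₁ → ℝ) × (Fin n₂ → ℝ)))
    (x₀ : Fin n → ℝ) (u₀ : Fin m → ℝ)
    (P : (Fin n → ℝ) × (Fin m → ℝ) →
      Submodule ℝ ((Fin n → ℝ) × (Fin m → ℝ) →L[ℝ] ℝ)) : Prop :=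
  IsDiffeoAround Φ x₀ ∧ ∀ᶠ p in 𝓝 (x₀, u₀), P p = dspan (fun q => (Φ q.1).2) p

end System

/-! ### Calculus: local diffeomorphisms, smooth right inverses, cutoffs -/

section Calculus

variable {E F X Y : Type*} [NormedAddCommGroup E] [NormedSpace ℝ E]
  [NormedAddCommGroup F] [NormedSpace ℝ F]
  [NormedAddCommGroup X] [NormedSpace ℝ X] [NormedAddCommGroup Y] [NormedSpace ℝ Y]

/-! At a point p the forms in P₁ ∩ span{df} are exactly the l ∘ df(p) with l annihilating im ∂_u
f(p). Invariance under ker df spreads such coefficients l along the fibres of f. Everything rests on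
the resulting description: wherever the backward-shift is defined, the space N(y) of coefficients of
P₂ at y ∈ f(W) is `fibreForms f W y`, the span of the annihilators of im ∂_u f at all points of W
over y.

One inclusion is minimality (`IsSystemAround.P2plus_le`): for v in ker df, L_v(l ∘ df) = (D_v l) ∘
df, and if l takes values in a subspace depending only on the value of f, so does D_v l; hence the
pullback of `fibreForms` is invariant. The other holds because N depends on y only, and so contains
the contributions of all points over y.

A shift exists (`IsSystemAround.exists_P2`) because a basis of P₂⁺ can be normalized so that its
coefficients have zero derivative along ker df; in a box adapted to f they are then functions of f
alone.

P₂ is integrable without Frobenius: a form annihilating im ∂_u f(p) extends to an exact form with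
values in `fibreForms`, by means of a local section of f through p and the constant rank of ∂_u f
(`IsSystemAround.exists_potential`). Hence N is spanned by d exact forms near x₀
(`IsShiftField.exists_straightening`).

A triangular form forces all fibre forms at x₀ to kill a common nonzero vector
(`IsTriangularForm.finrank_lt`). Conversely, once N = span{dx̄₂}, the kernel of dx̄₂ lies in im ∂_u
f, so the inputs control x̄₁⁺ completely, while ∂_u x̄₂⁺ has constant rank ρ; taking ρ components of
x̄₂⁺ as ū₂ removes the remaining inputs from x̄₂⁺ (`IsShiftField.exists_completion`). -/

theorem bijective_iff_exists_equiv [FiniteDimensional ℝ E] [FiniteDimensional ℝ F]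
    {A : E →L[ℝ] F} : Function.Bijective A ↔ ∃ e : E ≃L[ℝ] F, (e : E →L[ℝ] F) = A := by
  constructor
  · intro h
    refine ⟨(LinearEquiv.ofBijective (A : E →ₗ[ℝ] F) h).toContinuousLinearEquiv, ?_⟩
    ext x
    rfl
  · rintro ⟨e, rfl⟩
    exact e.bijective

theorem isOpen_bijective [FiniteDimensional ℝ E] [FiniteDimensional ℝ F] :
    IsOpen {A : E →L[ℝ] F | Function.Bijective A} := by
  have : {A : E →L[ℝ] F | Function.Bijective A}
      = Set.range ((↑) : (E ≃L[ℝ] F) → (E →L[ℝ] F)) := by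
    ext A
    simp [bijective_iff_exists_equiv]
  rw [this]
  have := FiniteDimensional.complete ℝ E
  exact ContinuousLinearEquiv.isOpen

/-- The inverse function theorem with a ball as target. -/
theorem exists_diffeoAround_ball [FiniteDimensional ℝ E] [FiniteDimensional ℝ F]
    {g : E → F} {U : Set E} {p : E} (hU : IsOpen U) (hp : p ∈ U) (hg : ContDiffOn ℝ ∞ g U)
    (hbij : Function.Bijective (fderiv ℝ g p)) :
    ∃ e : OpenPartialHomeomorph E F, IsDiffeoAround e p ∧ (⇑e = g) ∧ e.source ⊆ U ∧
      (∃ ε > 0, e.target = Metric.ball (g p) ε) ∧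
      ∀ q ∈ e.source, Function.Bijective (fderiv ℝ g q) := by
  have hcE := FiniteDimensional.complete ℝ E
  have hcF := FiniteDimensional.complete ℝ F
  obtain ⟨A, hA⟩ := bijective_iff_exists_equiv.1 hbij
  have hga : ContDiffAt ℝ ∞ g p := hg.contDiffAt (hU.mem_nhds hp)
  have hd : HasFDerivAt g (A : E →L[ℝ] F) p := by
    rw [hA]; exact (hga.differentiableAt (by simp)).hasFDerivAt
  let e₀ := hga.toOpenPartialHomeomorph g hd (by simp)
  have hcont : ContinuousOn (fderiv ℝ g) U :=
    hg.continuousOn_fderiv_of_isOpen hU (by simp)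
  let U' : Set E := U ∩ fderiv ℝ g ⁻¹' {A | Function.Bijective A}
  have hU' : IsOpen U' := hcont.isOpen_inter_preimage hU isOpen_bijective
  have hpU' : p ∈ U' := ⟨hp, hbij⟩
  let e₁ := e₀.restrOpen U' hU'
  have hps : p ∈ e₁.source := by
    rw [OpenPartialHomeomorph.restrOpen_source]
    exact ⟨hga.mem_toOpenPartialHomeomorph_source hd (by simp), hpU'⟩
  have hcoe : ⇑e₁ = g := rfl
  have hgp : g p ∈ e₁.target := hcoe ▸ e₁.map_source hps
  obtain ⟨ε, hε, hball⟩ := Metric.isOpen_iff.1 e₁.open_target _ hgp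
  -- Restricting the inverse makes the target exactly a ball: convex, and in the sup norm of a
  -- product also a product of balls.
  let e := (e₁.symm.restrOpen (Metric.ball (g p) ε) Metric.isOpen_ball).symm
  have hecoe : ⇑e = g := rfl
  have htgt : e.target = Metric.ball (g p) ε := by
    change (e₁.symm.restrOpen (Metric.ball (g p) ε) Metric.isOpen_ball).source = _
    rw [OpenPartialHomeomorph.restrOpen_source]
    exact Set.inter_eq_right.2 hball
  have hsym : ∀ y, e.symm y = e₁.symm y := fun y => rfl
  have hsrc : ∀ q ∈ e.source, q ∈ e₁.source := by
    intro q hq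
    have h1 := e.map_source hq
    have h2 : e.symm (e q) = q := e.left_inv hq
    rw [htgt] at h1
    have h3 := e₁.map_target (hball h1)
    rw [← hsym, h2] at h3
    exact h3
  have hsrcU' : ∀ q ∈ e.source, q ∈ U' := by
    intro q hq
    have := hsrc q hq
    rw [OpenPartialHomeomorph.restrOpen_source] at this
    exact this.2
  refine ⟨e, ⟨?_, ?_, ?_⟩, hecoe, fun q hq => (hsrcU' q hq).1, ⟨ε, hε, htgt⟩,
    fun q hq => (hsrcU' q hq).2⟩
  · have : e.symm (g p) ∈ e.source := e.map_target (by rw [htgt]; exact Metric.mem_ball_self hε)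
    rw [hsym, ← hcoe, e₁.left_inv hps] at this
    exact this
  · exact hg.mono fun q hq => (hsrcU' q hq).1
  · intro y hy
    have hq := hsrcU' _ (e.map_target hy)
    obtain ⟨B, hB⟩ := bijective_iff_exists_equiv.1 hq.2
    have hgq : ContDiffAt ℝ ∞ g (e.symm y) := hg.contDiffAt (hU.mem_nhds hq.1)
    refine (e.contDiffAt_symm hy (f₀' := B) ?_ hgq).contDiffWithinAt
    rw [hB]
    exact (hgq.differentiableAt (by simp)).hasFDerivAt

theorem IsDiffeoAround.hasFDerivAt {e : OpenPartialHomeomorph E F} {p : E}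
    (h : IsDiffeoAround e p) {q : E} (hq : q ∈ e.source) : HasFDerivAt e (fderiv ℝ e q) q :=
  ((h.2.1.contDiffAt (e.open_source.mem_nhds hq)).differentiableAt (by simp)).hasFDerivAt

theorem IsDiffeoAround.hasFDerivAt_symm {e : OpenPartialHomeomorph E F} {p : E}
    (h : IsDiffeoAround e p) {y : F} (hy : y ∈ e.target) :
    HasFDerivAt e.symm (fderiv ℝ e.symm y) y :=
  ((h.2.2.contDiffAt (e.open_target.mem_nhds hy)).differentiableAt (by simp)).hasFDerivAt

theorem IsDiffeoAround.fderiv_symm_fderiv {e : OpenPartialHomeomorph E F} {p : E}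
    (h : IsDiffeoAround e p) {q : E} (hq : q ∈ e.source) (w : E) :
    fderiv ℝ e.symm (e q) (fderiv ℝ e q w) = w := by
  have h1 : HasFDerivAt (fun q => e.symm (e q)) _ q :=
    (h.hasFDerivAt_symm (e.map_source hq)).comp q (h.hasFDerivAt hq)
  have h2 : HasFDerivAt (fun q => e.symm (e q)) (ContinuousLinearMap.id ℝ E) q :=
    (hasFDerivAt_id q).congr_of_eventuallyEq
      ((e.open_source.eventually_mem hq).mono fun _ hq' => e.left_inv hq')
  exact DFunLike.congr_fun (h1.unique h2) w

theorem IsDiffeoAround.fderiv_fderiv_symm {e : OpenPartialHomeomorph E F} {p : E}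
    (h : IsDiffeoAround e p) {q : E} (hq : q ∈ e.source) (w : F) :
    fderiv ℝ e q (fderiv ℝ e.symm (e q) w) = w := by
  have hy := e.map_source hq
  have h0 : HasFDerivAt e (fderiv ℝ e q) (e.symm (e q)) := by
    rw [e.left_inv hq]; exact h.hasFDerivAt hq
  have h1 : HasFDerivAt (fun y => e (e.symm y)) _ (e q) := h0.comp (e q) (h.hasFDerivAt_symm hy)
  have h2 : HasFDerivAt (fun y => e (e.symm y)) (ContinuousLinearMap.id ℝ F) (e q) :=
    (hasFDerivAt_id (e q)).congr_of_eventuallyEq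
      ((e.open_target.eventually_mem hy).mono fun _ hy' => e.right_inv hy')
  exact DFunLike.congr_fun (h1.unique h2) w

/-- A function on a convex open set takes the same value at two points if its derivative in the
direction of their difference vanishes. -/
theorem Convex.eq_of_fderiv_sub_eq_zero {s : Set E} (hs : Convex ℝ s) {g : E → F}
    (hg : ∀ q ∈ s, DifferentiableAt ℝ g q) {x y : E} (hx : x ∈ s) (hy : y ∈ s)
    (h : ∀ q ∈ s, fderiv ℝ g q (y - x) = 0) : g y = g x := by
  let c : ℝ → E := fun t => x + t • (y - x)
  have hc : ∀ t ∈ Set.Icc (0 : ℝ) 1, c t ∈ s := fun t ht => hs.add_smul_sub_mem hx hy ht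
  have hcd : ∀ t, HasDerivAt c (y - x) t := fun t => by
    have h1 : HasDerivAt (fun t : ℝ => t • (y - x)) (y - x) t := by
      simpa using (hasDerivAt_id t).smul_const (y - x)
    exact h1.const_add x
  have hgc : ∀ t ∈ Set.Icc (0 : ℝ) 1, HasDerivAt (g ∘ c) 0 t := fun t ht => by
    have := (hg _ (hc t ht)).hasFDerivAt.comp_hasDerivAt t (hcd t)
    rwa [h _ (hc t ht)] at this
  have := constant_of_has_deriv_right_zero
    (fun t ht => (hgc t ht).continuousAt.continuousWithinAt)
    (fun t ht => (hgc t (Set.Ico_subset_Icc_self ht)).hasDerivWithinAt) 1 (by simp)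
  simpa [c] using this

theorem exists_rightInverse [FiniteDimensional ℝ Y] {A : X →L[ℝ] Y} (hA : Function.Surjective A) :
    ∃ L : Y →L[ℝ] X, A.comp L = ContinuousLinearMap.id ℝ Y := by
  obtain ⟨L, hL⟩ := (A : X →ₗ[ℝ] Y).exists_rightInverse_of_surjective (LinearMap.range_eq_top.2 hA)
  refine ⟨LinearMap.toContinuousLinearMap L, ?_⟩
  ext y
  exact LinearMap.congr_fun hL y

/-- A smooth family of linear maps has, near a point where it is bijective, a smooth inverse. -/
theorem exists_smooth_inverse [FiniteDimensional ℝ X] [FiniteDimensional ℝ Y]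
    {A : E → X →L[ℝ] Y} {U : Set E} {p : E} (hU : IsOpen U) (hp : p ∈ U)
    (hA : ContDiffOn ℝ ∞ A U) (hb : Function.Bijective (A p)) :
    ∃ V, IsOpen V ∧ p ∈ V ∧ V ⊆ U ∧ ∃ s : E → Y →L[ℝ] X, ContDiffOn ℝ ∞ s V ∧
      ∀ q ∈ V, (A q).comp (s q) = ContinuousLinearMap.id ℝ Y ∧
        (s q).comp (A q) = ContinuousLinearMap.id ℝ X := by
  have hcX := FiniteDimensional.complete ℝ X
  refine ⟨U ∩ A ⁻¹' {B | Function.Bijective B},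
    hA.continuousOn.isOpen_inter_preimage hU isOpen_bijective, ⟨hp, hb⟩, Set.inter_subset_left,
    fun q => (A q).inverse, ?_, ?_⟩
  · rintro q ⟨hqU, hq⟩
    obtain ⟨e, he⟩ := bijective_iff_exists_equiv.1 hq
    have h1 : ContDiffAt ℝ ∞ ContinuousLinearMap.inverse (A q) := by
      rw [← he]; exact contDiffAt_map_inverse e
    exact (h1.comp q (hA.contDiffAt (hU.mem_nhds hqU))).contDiffWithinAt
  · rintro q ⟨hqU, hq⟩
    obtain ⟨e, he⟩ := bijective_iff_exists_equiv.1 hq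
    simp only [← he, ContinuousLinearMap.inverse_equiv]
    constructor <;> ext x <;> simp

/-- A smooth family of linear maps has, near a point where it is onto, a smooth right inverse. -/
theorem exists_smooth_rightInverse [FiniteDimensional ℝ Y]
    {A : E → X →L[ℝ] Y} {U : Set E} {p : E} (hU : IsOpen U) (hp : p ∈ U)
    (hA : ContDiffOn ℝ ∞ A U) (hb : Function.Surjective (A p)) :
    ∃ V, IsOpen V ∧ p ∈ V ∧ V ⊆ U ∧ ∃ s : E → Y →L[ℝ] X, ContDiffOn ℝ ∞ s V ∧
      ∀ q ∈ V, (A q).comp (s q) = ContinuousLinearMap.id ℝ Y := by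
  -- With a right inverse L frozen at p, `A q ∘ L` is the identity at p and stays invertible nearby.
  obtain ⟨L, hL⟩ := exists_rightInverse hb
  obtain ⟨V, hV, hpV, hVU, s, hs, hs'⟩ := exists_smooth_inverse (A := fun q => (A q).comp L) hU hp
    (hA.clm_comp contDiffOn_const) (by simp only [hL]; exact Function.bijective_id)
  refine ⟨V, hV, hpV, hVU, fun q => L.comp (s q), contDiffOn_const.clm_comp hs, fun q hq => ?_⟩
  rw [← ContinuousLinearMap.comp_assoc]
  exact (hs' q hq).1

/-- A smooth function on an open set can be cut off to a globally smooth function without changing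
it near a given point. -/
theorem exists_cutoff [FiniteDimensional ℝ E] {g : E → F} {U : Set E} {p : E} (hU : IsOpen U)
    (hp : p ∈ U) (hg : ContDiffOn ℝ ∞ g U) :
    ∃ χ : E → ℝ, ContDiff ℝ ∞ (fun q => χ q • g q) ∧ (∀ᶠ q in 𝓝 p, χ q = 1) ∧
      ∀ q ∉ U, χ q = 0 := by
  obtain ⟨χ₀, hsub, -, hχ, -, hχp⟩ :=
    exists_contDiff_tsupport_subset (n := ⊤) (hU.mem_nhds hp)
  -- χ₀ is only known to be 1 at p itself; a step function that is 1 above 1/2 makes the cutoff 1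
  -- near p.
  let ψ : ℝ → ℝ := fun t => Real.smoothTransition (2 * t)
  have hψ : ContDiff ℝ ∞ ψ := Real.smoothTransition.contDiff.comp (contDiff_const.mul contDiff_id)
  have hψχ : ContDiff ℝ ∞ (ψ ∘ χ₀) := hψ.comp hχ
  have hsupp : ∀ q ∉ tsupport χ₀, ψ (χ₀ q) = 0 := by
    intro q hq
    simp [ψ, image_eq_zero_of_notMem_tsupport hq]
  refine ⟨ψ ∘ χ₀, ?_, ?_, fun q hq => hsupp q fun h => hq (hsub h)⟩
  · rw [contDiff_iff_contDiffAt]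
    intro q
    by_cases hq : q ∈ tsupport χ₀
    · exact hψχ.contDiffAt.smul (hg.contDiffAt (hU.mem_nhds (hsub hq)))
    · have : (fun q => (ψ ∘ χ₀) q • g q) =ᶠ[𝓝 q] fun _ => 0 := by
        filter_upwards [(isClosed_tsupport χ₀).isOpen_compl.mem_nhds hq] with q' hq'
        simp [hsupp q' hq']
      exact contDiffAt_const.congr_of_eventuallyEq this
  · have : ∀ᶠ q in 𝓝 p, 1 / 2 < χ₀ q :=
      hχ.continuous.continuousAt.eventually (lt_mem_nhds (by rw [hχp]; norm_num))
    filter_upwards [this] with q hq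
    exact Real.smoothTransition.one_of_one_le (by linarith)

end Calculus

/-! ### Linear algebra: completions and right inverses -/

section LinearAlgebra

variable {X Y : Type*} [NormedAddCommGroup X] [NormedSpace ℝ X] [NormedAddCommGroup Y]
  [NormedSpace ℝ Y]

/-- A linear map onto `ℝᵏ` can be completed to a linear isomorphism. -/
theorem exists_bijective_prod [FiniteDimensional ℝ X] {N k : ℕ} (hN : Module.finrank ℝ X = N)
    {T : X →L[ℝ] (Fin k → ℝ)} (hT : Function.Surjective T) :
    ∃ κ : X →L[ℝ] (Fin (N - k) → ℝ), Function.Bijective (κ.prod T) := by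
  have hk : Module.finrank ℝ T.ker = N - k := by
    have := (T : X →ₗ[ℝ] (Fin k → ℝ)).finrank_range_add_finrank_ker
    rw [LinearMap.range_eq_top.2 hT, finrank_top, Module.finrank_fin_fun, hN] at this
    change Module.finrank ℝ (LinearMap.ker (T : X →ₗ[ℝ] (Fin k → ℝ))) = _
    omega
  have e : T.ker ≃ₗ[ℝ] (Fin (N - k) → ℝ) :=
    LinearEquiv.ofFinrankEq _ _ (by rw [hk, Module.finrank_fin_fun])
  obtain ⟨π, hπ⟩ := (LinearMap.ker (T : X →ₗ[ℝ] (Fin k → ℝ))).subtype.exists_leftInverse_of_injective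
    (Submodule.ker_subtype _)
  let κ : X →L[ℝ] (Fin (N - k) → ℝ) := LinearMap.toContinuousLinearMap (e.toLinearMap.comp π)
  have hinj : Function.Injective (κ.prod T) := by
    rw [injective_iff_map_eq_zero]
    intro x hx
    obtain ⟨h1, h2⟩ := Prod.mk_eq_zero.1 hx
    have h3 : π x = ⟨x, h2⟩ := LinearMap.congr_fun hπ ⟨x, h2⟩
    have h4 : π x = 0 := e.map_eq_zero_iff.1 h1
    rw [h4] at h3
    exact (congrArg Subtype.val h3).symm
  have hkN : k ≤ N := by
    have := LinearMap.finrank_le_finrank_of_surjective (f := (T : X →ₗ[ℝ] (Fin k → ℝ))) hT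
    rwa [Module.finrank_fin_fun, hN] at this
  have hfin : Module.finrank ℝ X = Module.finrank ℝ ((Fin (N - k) → ℝ) × (Fin k → ℝ)) := by
    rw [Module.finrank_prod, Module.finrank_fin_fun, Module.finrank_fin_fun, hN]
    omega
  exact ⟨κ, hinj, (LinearMap.injective_iff_surjective_of_finrank_eq_finrank
    (f := (κ.prod T).toLinearMap) hfin).1 hinj⟩

/-- A vector annihilated by all linear forms vanishing on the range of `A` is in the range. -/
theorem mem_range_of_forall_dual [FiniteDimensional ℝ Y] {A : X →L[ℝ] Y} {w : Y}
    (h : ∀ l : Y →L[ℝ] ℝ, l.comp A = 0 → l w = 0) : ∃ x, A x = w := by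
  by_contra hw
  have hw' : w ∉ LinearMap.range (A : X →ₗ[ℝ] Y) := by
    rintro ⟨x, hx⟩; exact hw ⟨x, hx⟩
  obtain ⟨l, hl, hl'⟩ := Submodule.exists_le_ker_of_notMem hw'
  refine hl (h (LinearMap.toContinuousLinearMap l) ?_)
  ext x
  exact hl' ⟨x, rfl⟩

/-- A linear map from `X × Z` onto `Y` has a right inverse that maps the image of `Z` into `Z`. -/
theorem exists_adapted_rightInverse {Z : Type*} [NormedAddCommGroup Z] [NormedSpace ℝ Z]
    [FiniteDimensional ℝ Y] {A : X × Z →L[ℝ] Y} (hA : Function.Surjective A) :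
    ∃ L : Y →L[ℝ] X × Z, A.comp L = ContinuousLinearMap.id ℝ Y ∧ ∀ z, (L (A (0, z))).1 = 0 := by
  let C : Z →ₗ[ℝ] Y := (A : X × Z →ₗ[ℝ] Y).comp (LinearMap.inr ℝ X Z)
  obtain ⟨t, ht⟩ := (A : X × Z →ₗ[ℝ] Y).exists_rightInverse_of_surjective
    (LinearMap.range_eq_top.2 hA)
  obtain ⟨s, hs⟩ := C.rangeRestrict.exists_rightInverse_of_surjective C.range_rangeRestrict
  obtain ⟨π, hπ⟩ := (LinearMap.range C).subtype.exists_leftInverse_of_injective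
    (Submodule.ker_subtype _)
  have hCs : ∀ k, A (0, s k) = k := fun k => congrArg Subtype.val (LinearMap.congr_fun hs k)
  have hAt : ∀ y, A (t y) = y := fun y => LinearMap.congr_fun ht y
  -- π projects Y onto the image of Z. The projected part is lifted into Z by s, the remainder by an
  -- arbitrary right inverse t.
  refine ⟨LinearMap.toContinuousLinearMap ((LinearMap.inr ℝ X Z).comp (s.comp π) +
    t.comp (LinearMap.id - (LinearMap.range C).subtype.comp π)), ?_, ?_⟩
  · ext y
    simp [hCs, hAt]
  · intro z
    have : π (A (0, z)) = ⟨A (0, z), z, rfl⟩ := LinearMap.congr_fun hπ ⟨A (0, z), z, rfl⟩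
    simp [this]

end LinearAlgebra

/-! ### Pullbacks of forms and derivatives along fibres -/

section Forms

variable {E F : Type*} [NormedAddCommGroup E] [NormedSpace ℝ E]
  [NormedAddCommGroup F] [NormedSpace ℝ F]

/-- The pullback `l ↦ l ∘ A` of linear forms. -/
noncomputable def pullForm (A : E →L[ℝ] F) : (F →L[ℝ] ℝ) →ₗ[ℝ] (E →L[ℝ] ℝ) :=
  ((ContinuousLinearMap.compL ℝ E F ℝ).flip A).toLinearMap

@[simp] theorem pullForm_apply (A : E →L[ℝ] F) (l : F →L[ℝ] ℝ) : pullForm A l = l.comp A := rfl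

theorem pullForm_injective {A : E →L[ℝ] F} (hA : Function.Surjective A) :
    Function.Injective (pullForm A) := by
  intro l l' h
  ext y
  obtain ⟨x, rfl⟩ := hA y
  exact DFunLike.congr_fun h x

theorem span_range_proj_comp {k : ℕ} (A : E →L[ℝ] (Fin k → ℝ)) :
    Submodule.span ℝ (Set.range fun i =>
      (ContinuousLinearMap.proj (R := ℝ) (φ := fun _ : Fin k => ℝ) i).comp A)
      = LinearMap.range (pullForm A) := by
  ext ζ
  rw [Submodule.mem_span_range_iff_exists_fun]
  constructor
  · rintro ⟨c, rfl⟩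
    refine ⟨∑ i, c i • ContinuousLinearMap.proj (R := ℝ) (φ := fun _ : Fin k => ℝ) i, ?_⟩
    ext w
    simp
  · rintro ⟨l, rfl⟩
    refine ⟨fun i => l (Pi.single i 1), ?_⟩
    ext w
    have : A w = ∑ i, (A w i) • (Pi.single i 1 : Fin k → ℝ) := by
      ext j
      simp [Finset.sum_apply, Pi.single_apply]
    rw [pullForm_apply, ContinuousLinearMap.comp_apply, this, map_sum]
    simp [mul_comm]

theorem span_range_eq_range_pullForm_pi {k : ℕ} (η : Fin k → E →L[ℝ] ℝ) :
    Submodule.span ℝ (Set.range η) = LinearMap.range (pullForm (ContinuousLinearMap.pi η)) := by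
  rw [← span_range_proj_comp]
  rfl

theorem dspan_eq_range {k : ℕ} {g : E → (Fin k → ℝ)} {p : E} (hg : DifferentiableAt ℝ g p) :
    dspan g p = LinearMap.range (pullForm (fderiv ℝ g p)) := by
  have h (i : Fin k) : fderiv ℝ (fun q => g q i) p
      = (ContinuousLinearMap.proj (R := ℝ) (φ := fun _ : Fin k => ℝ) i).comp (fderiv ℝ g p) :=
    (hasFDerivAt_pi'.1 hg.hasFDerivAt i).fderiv
  simp only [dspan, h]
  exact span_range_proj_comp _

theorem mem_dspan_iff {k : ℕ} {g : E → (Fin k → ℝ)} {p : E} (hg : DifferentiableAt ℝ g p)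
    {ζ : E →L[ℝ] ℝ} :
    ζ ∈ dspan g p ↔ ∃ l : (Fin k → ℝ) →L[ℝ] ℝ, l.comp (fderiv ℝ g p) = ζ := by
  rw [dspan_eq_range hg]
  rfl

/-- Linearly independent forms are the components of a map onto `ℝᵏ`. -/
theorem surjective_pi_of_linearIndependent {k : ℕ} {η : Fin k → E →L[ℝ] ℝ}
    (h : LinearIndependent ℝ η) : Function.Surjective (ContinuousLinearMap.pi η) := by
  refine fun y => mem_range_of_forall_dual fun l hl => ?_
  have h1 : ∑ i, l (Pi.single i 1) • η i = 0 := by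
    ext w
    have h2 := DFunLike.congr_fun hl w
    have : ContinuousLinearMap.pi η w = ∑ i, (η i w) • (Pi.single i 1 : Fin k → ℝ) := by
      ext j
      simp [Finset.sum_apply, Pi.single_apply]
    rw [ContinuousLinearMap.comp_apply, this, map_sum] at h2
    simpa [mul_comm] using h2
  have h3 := Fintype.linearIndependent_iff.1 h _ h1
  have : y = ∑ i, (y i) • (Pi.single i 1 : Fin k → ℝ) := by
    ext j
    simp [Finset.sum_apply, Pi.single_apply]
  rw [this, map_sum]
  simp [h3]

theorem mem_annihilator_dspan_iff {k : ℕ} {g : E → (Fin k → ℝ)} {p : E}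
    (hg : DifferentiableAt ℝ g p) {w : E} :
    w ∈ annihilator (dspan g) p ↔ fderiv ℝ g p w = 0 := by
  change (∀ ζ ∈ dspan g p, ζ w = 0) ↔ _
  constructor
  · intro h
    ext i
    exact h _ ((mem_dspan_iff hg).2
      ⟨ContinuousLinearMap.proj (R := ℝ) (φ := fun _ : Fin k => ℝ) i, rfl⟩)
  · intro h ζ hζ
    obtain ⟨l, rfl⟩ := (mem_dspan_iff hg).1 hζ
    simp [h]

/-- The Lie derivative of a combination of the differentials `df` along a vector field in the
kernel of `df`. -/
theorem lieDerivForm_comp {f : E → F} {p : E} (hf : ContDiffAt ℝ ∞ f p) {v : E → E}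
    {l : E → F →L[ℝ] ℝ} {η : E → E →L[ℝ] ℝ} (hv : DifferentiableAt ℝ v p)
    (hl : DifferentiableAt ℝ l p) (hη : η =ᶠ[𝓝 p] fun q => (l q).comp (fderiv ℝ f q))
    (hker : ∀ᶠ q in 𝓝 p, fderiv ℝ f q (v q) = 0) :
    lieDerivForm v η p = (fderiv ℝ l p (v p)).comp (fderiv ℝ f p) := by
  have hDf : DifferentiableAt ℝ (fderiv ℝ f) p :=
    (hf.fderiv_right (m := ∞) (by simp)).differentiableAt (by simp)
  have h1 := (hl.hasFDerivAt.clm_comp hDf.hasFDerivAt).fderiv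
  -- Differentiating df(v) = 0 trades the term with the derivative of v for a second derivative of
  -- f, which cancels by symmetry.
  have h2 : HasFDerivAt (fun q => fderiv ℝ f q (v q)) (0 : E →L[ℝ] F) p :=
    (hasFDerivAt_const (0 : F) p).congr_of_eventuallyEq hker
  have h3 := (hDf.hasFDerivAt.clm_apply hv.hasFDerivAt).unique h2
  have hsymm : IsSymmSndFDerivAt ℝ f p := hf.isSymmSndFDerivAt (by
    rw [minSmoothness_of_isRCLikeNormedField]; exact WithTop.coe_le_coe.2 le_top)
  ext w
  have h4 := DFunLike.congr_fun h3 w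
  have h5 := congrArg (l p) h4
  simp only [add_apply, ContinuousLinearMap.comp_apply,
    ContinuousLinearMap.flip_apply, map_add] at h5
  have h6 := hsymm (v p) w
  simp only [lieDerivForm, hη.fderiv_eq, h1, hη.eq_of_nhds]
  simp [h6] at h5 ⊢
  linarith

/-- The derivative along a fibre of `f` of a vector-valued function that stays in subspaces
depending only on the value of `f`. -/
theorem fderiv_mem_of_mem_fibre {V : Type*} [NormedAddCommGroup V] [NormedSpace ℝ V]
    [FiniteDimensional ℝ V] [CompleteSpace E] [FiniteDimensional ℝ F] {f : E → F} {p : E}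
    (hf : ContDiffAt ℝ ∞ f p) (hsurj : Function.Surjective (fderiv ℝ f p)) (S : F → Submodule ℝ V)
    {l : E → V} (hl : DifferentiableAt ℝ l p) (hS : ∀ᶠ q in 𝓝 p, l q ∈ S (f q)) {w : E}
    (hw : fderiv ℝ f p w = 0) : fderiv ℝ l p w ∈ S (f p) := by
  have hcF := FiniteDimensional.complete ℝ F
  have hs : HasStrictFDerivAt f (fderiv ℝ f p) p := hf.hasStrictFDerivAt (by simp)
  have hr : (fderiv ℝ f p).range = ⊤ := LinearMap.range_eq_top.2 hsurj
  -- A curve inside the fibre of f through p with velocity w.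
  let c : ℝ → E := fun t => hs.implicitFunction f _ hr (f p) (t • ⟨w, hw⟩)
  have hc0 : c 0 = p := by
    simp only [c, zero_smul]
    exact hs.implicitFunction_apply_image hr
  have hcd : HasDerivAt c w 0 := by
    have h1 := hs.to_implicitFunction hr
    have h2 : HasDerivAt (fun t : ℝ => t • (⟨w, hw⟩ : (fderiv ℝ f p).ker)) ⟨w, hw⟩ 0 := by
      simpa using (hasDerivAt_id (0 : ℝ)).smul_const (⟨w, hw⟩ : (fderiv ℝ f p).ker)
    have h3 : HasFDerivAt (hs.implicitFunction f _ hr (f p)) (fderiv ℝ f p).ker.subtypeL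
        ((0 : ℝ) • (⟨w, hw⟩ : (fderiv ℝ f p).ker)) := by
      rw [zero_smul]; exact h1.hasFDerivAt
    exact h3.comp_hasDerivAt 0 h2
  have hfc : ∀ᶠ t in 𝓝 0, f (c t) = f p := by
    have h1 := hs.map_implicitFunction_eq hr
    have h2 : Filter.Tendsto (fun t : ℝ => (f p, t • (⟨w, hw⟩ : (fderiv ℝ f p).ker))) (𝓝 0)
        (𝓝 (f p, 0)) := by
      have : Continuous (fun t : ℝ => (f p, t • (⟨w, hw⟩ : (fderiv ℝ f p).ker))) := by fun_prop
      simpa using this.tendsto 0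
    exact h2.eventually h1
  have hcc : Filter.Tendsto c (𝓝 0) (𝓝 p) := by
    have := hcd.continuousAt.tendsto
    rwa [hc0] at this
  have hlc : HasDerivAt (l ∘ c) (fderiv ℝ l p w) 0 := by
    refine HasFDerivAt.comp_hasDerivAt 0 ?_ hcd
    rw [hc0]; exact hl.hasFDerivAt
  have hmem : ∀ᶠ t in 𝓝 0, (l ∘ c) t ∈ S (f p) := by
    filter_upwards [hcc.eventually hS, hfc] with t h1 h2
    rwa [h2] at h1
  -- The difference quotients of l along c lie in the fixed subspace `S (f p)`, which is closed, so
  -- their limit does too.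
  have hcl : IsClosed (S (f p) : Set V) := (S (f p)).closed_of_finiteDimensional
  refine hcl.mem_of_tendsto (hasDerivAt_iff_tendsto_slope.1 hlc) ?_
  filter_upwards [hmem.filter_mono nhdsWithin_le_nhds] with t ht
  exact (S (f p)).smul_mem _ ((S (f p)).sub_mem ht hmem.self_of_nhds)

end Forms

/-! ### P₂⁺ and the forms collected along the fibres of f -/

section System

variable {n m : ℕ} {f : (Fin n → ℝ) × (Fin m → ℝ) → (Fin n → ℝ)}
  {O : Set ((Fin n → ℝ) × (Fin m → ℝ))} {x₀ : Fin n → ℝ} {u₀ : Fin m → ℝ}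

theorem IsSystemAround.contDiffAt (hf : IsSystemAround f O x₀ u₀)
    {p : (Fin n → ℝ) × (Fin m → ℝ)} (hp : p ∈ O) : ContDiffAt ℝ ∞ f p :=
  hf.smooth.contDiffAt (hf.isOpen.mem_nhds hp)

theorem IsSystemAround.differentiableAt (hf : IsSystemAround f O x₀ u₀)
    {p : (Fin n → ℝ) × (Fin m → ℝ)} (hp : p ∈ O) : DifferentiableAt ℝ f p :=
  (hf.contDiffAt hp).differentiableAt (by simp)

theorem IsSystemAround.surjective (hf : IsSystemAround f O x₀ u₀)
    {p : (Fin n → ℝ) × (Fin m → ℝ)} (hp : p ∈ O) : Function.Surjective (fderiv ℝ f p) := by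
  refine LinearMap.range_eq_top.1 (Submodule.eq_top_of_finrank_eq ?_)
  rw [Module.finrank_fin_fun]
  exact hf.submersive p hp

theorem IsSystemAround.contDiffOn_fderiv (hf : IsSystemAround f O x₀ u₀) :
    ContDiffOn ℝ ∞ (fderiv ℝ f) O :=
  hf.smooth.fderiv_of_isOpen hf.isOpen (by simp)

theorem IsSystemAround.isOpen_image (hf : IsSystemAround f O x₀ u₀)
    {W : Set ((Fin n → ℝ) × (Fin m → ℝ))} (hW : IsOpen W) (hWO : W ⊆ O) : IsOpen (f '' W) := by
  rw [isOpen_iff_mem_nhds]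
  rintro _ ⟨p, hp, rfl⟩
  have hs : HasStrictFDerivAt f (fderiv ℝ f p) p :=
    (hf.contDiffAt (hWO hp)).hasStrictFDerivAt (by simp)
  rw [← hs.map_nhds_eq_of_surj (LinearMap.range_eq_top.2 (hf.surjective (hWO hp)))]
  exact Filter.image_mem_map (hW.mem_nhds hp)

theorem mem_P1_iff {p : (Fin n → ℝ) × (Fin m → ℝ)} {ζ : (Fin n → ℝ) × (Fin m → ℝ) →L[ℝ] ℝ} :
    ζ ∈ P1 n m p ↔ ∀ u, ζ (0, u) = 0 := by
  rw [P1, mem_dspan_iff differentiableAt_fst, fderiv_fst]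
  constructor
  · rintro ⟨l, rfl⟩ u
    simp
  · intro h
    refine ⟨ζ.comp (ContinuousLinearMap.inl ℝ _ _), ?_⟩
    ext w <;> simp [h]

/-- The span of the forms at `y` that annihilate the image of `∂_u f` at some point of `W` over
`y`. -/
noncomputable def fibreForms (f : (Fin n → ℝ) × (Fin m → ℝ) → (Fin n → ℝ))
    (W : Set ((Fin n → ℝ) × (Fin m → ℝ))) (y : Fin n → ℝ) : Submodule ℝ ((Fin n → ℝ) →L[ℝ] ℝ) :=
  Submodule.span ℝ {l | ∃ p ∈ W, f p = y ∧ ∀ u, l (fderiv ℝ f p (0, u)) = 0}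

theorem IsSystemAround.mem_inf_iff (hf : IsSystemAround f O x₀ u₀)
    {p : (Fin n → ℝ) × (Fin m → ℝ)} (hp : p ∈ O) {ζ : (Fin n → ℝ) × (Fin m → ℝ) →L[ℝ] ℝ} :
    ζ ∈ (P1 n m ⊓ dspan f) p ↔
      ∃ l : (Fin n → ℝ) →L[ℝ] ℝ, (∀ u, l (fderiv ℝ f p (0, u)) = 0) ∧
        l.comp (fderiv ℝ f p) = ζ := by
  rw [Pi.inf_apply, Submodule.mem_inf, mem_P1_iff, mem_dspan_iff (hf.differentiableAt hp)]
  constructor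
  · rintro ⟨h, l, rfl⟩
    exact ⟨l, h, rfl⟩
  · rintro ⟨l, h, rfl⟩
    exact ⟨h, l, rfl⟩

theorem IsSystemAround.comp_mem_P2plus (hf : IsSystemAround f O x₀ u₀)
    {p : (Fin n → ℝ) × (Fin m → ℝ)} (hp : p ∈ O) {l : (Fin n → ℝ) →L[ℝ] ℝ}
    (hl : ∀ u, l (fderiv ℝ f p (0, u)) = 0) : l.comp (fderiv ℝ f p) ∈ P2plus f O p :=
  (smallestInvariant_isLeast O _ _).1.1 p hp ((hf.mem_inf_iff hp).2 ⟨l, hl, rfl⟩)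

-- By minimality of P₂⁺ it suffices that the right-hand side extends to an invariant field
-- containing P₁ ∩ span{df}. Invariance holds because the coefficient spaces are constant on fibres,
-- so derivatives along ker df stay in them.
open Classical in
theorem IsSystemAround.P2plus_le (hf : IsSystemAround f O x₀ u₀)
    {W : Set ((Fin n → ℝ) × (Fin m → ℝ))} (hW : IsOpen W) (hWO : W ⊆ O)
    {p : (Fin n → ℝ) × (Fin m → ℝ)} (hp : p ∈ W) :
    P2plus f O p ≤ (fibreForms f W (f p)).map (pullForm (fderiv ℝ f p)) := by
  -- The value ⊤ off W makes the conditions there void, so a bound on the smallest field over O can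
  -- be tested on W alone.
  let Q : (Fin n → ℝ) × (Fin m → ℝ) → Submodule ℝ ((Fin n → ℝ) × (Fin m → ℝ) →L[ℝ] ℝ) :=
    fun p => if p ∈ W then (fibreForms f W (f p)).map (pullForm (fderiv ℝ f p)) else ⊤
  have hQW : ∀ q ∈ W, Q q = (fibreForms f W (f q)).map (pullForm (fderiv ℝ f q)) :=
    fun q hq => if_pos hq
  intro ζ hζ
  rw [← hQW p hp]
  refine mem_smallestInvariant.1 hζ Q (fun q hq ζ hζ => ?_) ?_
  · by_cases hqW : q ∈ W
    · rw [hQW q hqW]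
      obtain ⟨l, hl, rfl⟩ := (hf.mem_inf_iff hq).1 hζ
      exact ⟨l, Submodule.subset_span ⟨q, hqW, rfl, hl⟩, rfl⟩
    · simp [Q, hqW]
  · intro v η hv hη hvD hηQ q hq
    by_cases hqW : q ∈ W
    swap
    · simp [Q, hqW]
    obtain ⟨V, hV, hqV, hVW, s, hs, hs'⟩ := exists_smooth_rightInverse hW hqW
      (hf.contDiffOn_fderiv.mono hWO) (hf.surjective (hWO hqW))
    let l := fun q' => (η q').comp (s q')
    have hl : ContDiffOn ℝ ∞ l V := (hη.mono (hVW.trans hWO)).clm_comp hs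
    have hld : DifferentiableAt ℝ l q := (hl.contDiffAt (hV.mem_nhds hqV)).differentiableAt (by simp)
    have key : ∀ q' ∈ V, η q' = (l q').comp (fderiv ℝ f q') ∧ l q' ∈ fibreForms f W (f q') := by
      intro q' hq'
      have h1 := hηQ q' (hWO (hVW hq'))
      rw [hQW q' (hVW hq')] at h1
      obtain ⟨l', hl', h2⟩ := h1
      have h3 : l q' = l' := by
        simp only [l, ← h2, pullForm_apply, ContinuousLinearMap.comp_assoc, hs' q' hq',
          ContinuousLinearMap.comp_id]
      rw [h3]
      exact ⟨h2.symm, hl'⟩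
    have hvker : ∀ q' ∈ O, fderiv ℝ f q' (v q') = 0 := fun q' hq' =>
      (mem_annihilator_dspan_iff (hf.differentiableAt hq')).1 (hvD q' hq')
    have hVq : ∀ᶠ q' in 𝓝 q, q' ∈ V := hV.mem_nhds hqV
    rw [hQW q hqW, lieDerivForm_comp (hf.contDiffAt hq)
      ((hv.contDiffAt (hf.isOpen.mem_nhds hq)).differentiableAt (by simp)) hld
      (hVq.mono fun q' hq' => (key q' hq').1)
      (hVq.mono fun q' hq' => hvker q' (hWO (hVW hq')))]
    exact ⟨_, fderiv_mem_of_mem_fibre (hf.contDiffAt hq) (hf.surjective hq) _ hld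
      (hVq.mono fun q' hq' => (key q' hq').2) (hvker q hq), rfl⟩

/-- A smooth form in `P₂⁺` given near `p` by a combination of the `dfⁱ`: the derivatives of its
coefficients along `ker df` are again coefficients of a form in `P₂⁺`. -/
theorem IsSystemAround.fderiv_comp_mem_P2plus (hf : IsSystemAround f O x₀ u₀)
    {V : Set ((Fin n → ℝ) × (Fin m → ℝ))} (hV : IsOpen V) (hVO : V ⊆ O)
    {l : (Fin n → ℝ) × (Fin m → ℝ) → ((Fin n → ℝ) →L[ℝ] ℝ)} (hl : ContDiffOn ℝ ∞ l V)
    (hlP : ∀ q ∈ V, (l q).comp (fderiv ℝ f q) ∈ P2plus f O q)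
    {p w : (Fin n → ℝ) × (Fin m → ℝ)} (hp : p ∈ V) (hw : fderiv ℝ f p w = 0) :
    (fderiv ℝ l p w).comp (fderiv ℝ f p) ∈ P2plus f O p := by
  obtain ⟨V', hV', hpV', hV'V, s, hs, hs'⟩ := exists_smooth_rightInverse hV hp
    (hf.contDiffOn_fderiv.mono hVO) (hf.surjective (hVO hp))
  have hDf := hf.contDiffOn_fderiv.mono (hV'V.trans hVO)
  obtain ⟨χ, hχ, hχ1, hχ0⟩ := exists_cutoff hV' hpV'
    (g := fun q => (l q).comp (fderiv ℝ f q)) ((hl.mono hV'V).clm_comp hDf)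
  -- Invariance is stated for fields smooth on all of O. The field w - s(df w) lies in ker df and
  -- equals w at p; it and the form are cut off outside V'.
  obtain ⟨ψ, hψ, hψ1, hψ0⟩ := exists_cutoff hV' hpV'
    (g := fun q => w - s q (fderiv ℝ f q w))
    (contDiffOn_const.sub (hs.clm_apply (hDf.clm_apply contDiffOn_const)))
  have hker : ∀ q, fderiv ℝ f q (ψ q • (w - s q (fderiv ℝ f q w))) = 0 := by
    intro q
    by_cases hq : q ∈ V'
    · have := DFunLike.congr_fun (hs' q hq) (fderiv ℝ f q w)
      simp only [ContinuousLinearMap.comp_apply, ContinuousLinearMap.id_apply] at this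
      rw [map_smul, map_sub, this, sub_self, smul_zero]
    · rw [hψ0 q hq, zero_smul, map_zero]
  have key := (smallestInvariant_isLeast O (annihilator (dspan f)) (P1 n m ⊓ dspan f)).1.2
    _ _ hψ.contDiffOn hχ.contDiffOn
    (fun q hq => (mem_annihilator_dspan_iff (hf.differentiableAt hq)).2 (hker q))
    (fun q hq => by
      by_cases hqV : q ∈ V'
      · exact Submodule.smul_mem _ _ (hlP q (hV'V hqV))
      · rw [hχ0 q hqV, zero_smul]; exact Submodule.zero_mem _) p (hVO hp)
  rw [lieDerivForm_comp (hf.contDiffAt (hVO hp)) (hψ.differentiable (by simp) p)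
    ((hl.contDiffAt (hV.mem_nhds hp)).differentiableAt (by simp))
    (hχ1.mono fun q hq => by simp only [hq, one_smul]) (Filter.Eventually.of_forall hker)] at key
  simp only [hψ1.self_of_nhds, hw, map_zero, sub_zero, one_smul] at key
  exact key

end System

/-! ### Existence of the backward-shift -/

section System

variable {n m : ℕ} {f : (Fin n → ℝ) × (Fin m → ℝ) → (Fin n → ℝ)}
  {O : Set ((Fin n → ℝ) × (Fin m → ℝ))} {x₀ : Fin n → ℝ} {u₀ : Fin m → ℝ}

theorem contDiffOn_clm_pi {E F : Type*} [NormedAddCommGroup E] [NormedSpace ℝ E]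
    [NormedAddCommGroup F] [NormedSpace ℝ F] [FiniteDimensional ℝ F] {k : ℕ}
    {η : Fin k → E → F →L[ℝ] ℝ} {V : Set E} (h : ∀ i, ContDiffOn ℝ ∞ (η i) V) :
    ContDiffOn ℝ ∞ (fun q => ContinuousLinearMap.pi fun i => η i q) V := by
  rw [contDiffOn_clm_apply]
  intro y
  rw [contDiffOn_pi]
  exact fun i => (h i).clm_apply contDiffOn_const

/-- Near any point `P₂⁺` is spanned by the components of `θ ∘ df` with `θ` constant along the
fibres of `f` to first order. -/
theorem IsSystemAround.exists_normalized (hf : IsSystemAround f O x₀ u₀) {d : ℕ}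
    (hplus : IsCodistributionOn O d (P2plus f O)) {p : (Fin n → ℝ) × (Fin m → ℝ)} (hp : p ∈ O) :
    ∃ V, IsOpen V ∧ p ∈ V ∧ V ⊆ O ∧
      ∃ μ : (Fin n → ℝ) × (Fin m → ℝ) → ((Fin n → ℝ) →L[ℝ] (Fin d → ℝ)),
        ContDiffOn ℝ ∞ μ V ∧
        (∀ q ∈ V, P2plus f O q = LinearMap.range (pullForm ((μ q).comp (fderiv ℝ f q)))) ∧
        ∀ q ∈ V, ∀ w, fderiv ℝ f q w = 0 → fderiv ℝ μ q w = 0 := by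
  obtain ⟨V₀, hV₀, hpV₀, hV₀O, η, hη, hηP⟩ := hplus p hp
  obtain ⟨V₁, hV₁, hpV₁, hV₁V₀, s, hs, hs'⟩ := exists_smooth_rightInverse hV₀ hpV₀
    (hf.contDiffOn_fderiv.mono hV₀O) (hf.surjective hp)
  let H : (Fin n → ℝ) × (Fin m → ℝ) → ((Fin n → ℝ) × (Fin m → ℝ) →L[ℝ] (Fin d → ℝ)) :=
    fun q => ContinuousLinearMap.pi fun i => η i q
  let l := fun q => (H q).comp (s q)
  have hl : ContDiffOn ℝ ∞ l V₁ := ((contDiffOn_clm_pi hη).mono hV₁V₀).clm_comp hs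
  have hPH : ∀ q ∈ V₀, P2plus f O q = LinearMap.range (pullForm (H q)) := fun q hq =>
    (hηP q hq).2.trans (span_range_eq_range_pullForm_pi _)
  have hlH : ∀ q ∈ V₁, (l q).comp (fderiv ℝ f q) = H q := by
    intro q hq
    refine ContinuousLinearMap.ext fun w => funext fun i => ?_
    have h1 : η i q ∈ P2plus f O q := by
      rw [(hηP q (hV₁V₀ hq)).2]
      exact Submodule.subset_span ⟨i, rfl⟩
    obtain ⟨l', -, hl'⟩ := hf.P2plus_le hf.isOpen subset_rfl (hV₀O (hV₁V₀ hq)) h1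
    have h2 := DFunLike.congr_fun (hs' q hq) (fderiv ℝ f q w)
    simp only [ContinuousLinearMap.comp_apply, ContinuousLinearMap.id_apply] at h2
    change η i q (s q (fderiv ℝ f q w)) = η i q w
    rw [← hl']
    simp [h2]
  have hlsurj : Function.Surjective (l p) := by
    have h1 := surjective_pi_of_linearIndependent (hηP p hpV₀).1
    intro y
    obtain ⟨x, hx⟩ := h1 y
    refine ⟨fderiv ℝ f p x, ?_⟩
    rw [← hx]
    exact DFunLike.congr_fun (hlH p hpV₁) x
  -- Normalization as in row reduction: μ = (l M)⁻¹ l spans the same forms as l and satisfies μ M =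
  -- id, so derivatives of μ vanish on the range of M.
  obtain ⟨M, hM⟩ := exists_rightInverse hlsurj
  obtain ⟨V, hV, hpV, hVV₁, B, hB, hB'⟩ := exists_smooth_inverse
    (A := fun q => (l q).comp M) hV₁ hpV₁ (hl.clm_comp contDiffOn_const)
    (by simp only [hM]; exact Function.bijective_id)
  let μ := fun q => (B q).comp (l q)
  have hμ : ContDiffOn ℝ ∞ μ V := hB.clm_comp (hl.mono hVV₁)
  have hμM : ∀ q ∈ V, (μ q).comp M = ContinuousLinearMap.id ℝ _ := fun q hq => by
    rw [ContinuousLinearMap.comp_assoc]; exact (hB' q hq).2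
  have hVO : V ⊆ O := fun q hq => hV₀O (hV₁V₀ (hVV₁ hq))
  have hPμ : ∀ q ∈ V, P2plus f O q =
      LinearMap.range (pullForm ((μ q).comp (fderiv ℝ f q))) := by
    intro q hq
    rw [hPH q (hV₁V₀ (hVV₁ hq)), ← hlH q (hVV₁ hq)]
    apply le_antisymm
    · rintro _ ⟨c, rfl⟩
      refine ⟨c.comp ((l q).comp M), ?_⟩
      have h1 := (hB' q hq).1
      refine ContinuousLinearMap.ext fun w => ?_
      have h2 := DFunLike.congr_fun h1 (l q (fderiv ℝ f q w))
      simp only [ContinuousLinearMap.comp_apply, ContinuousLinearMap.id_apply] at h2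
      simp [μ, h2]
    · rintro _ ⟨c, rfl⟩
      exact ⟨c.comp (B q), rfl⟩
  refine ⟨V, hV, hpV, hVO, μ, hμ, hPμ, fun q hq w hw => ?_⟩
  have hμd : DifferentiableAt ℝ μ q := (hμ.contDiffAt (hV.mem_nhds hq)).differentiableAt (by simp)
  have hDM : (fderiv ℝ μ q w).comp M = 0 := by
    have h1 : HasFDerivAt (fun q => (μ q).comp M) (0 : _ →L[ℝ] _) q :=
      (hasFDerivAt_const (ContinuousLinearMap.id ℝ (Fin d → ℝ)) q).congr_of_eventuallyEq
        ((hV.eventually_mem hq).mono hμM)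
    have h2 := (hμd.hasFDerivAt.clm_comp (hasFDerivAt_const M q)).unique h1
    have h3 := DFunLike.congr_fun h2 w
    simpa using h3
  ext y i
  let π := ContinuousLinearMap.proj (R := ℝ) (φ := fun _ : Fin d => ℝ) i
  have hπμ : ContDiffOn ℝ ∞ (fun q => π.comp (μ q)) V := contDiffOn_const.clm_comp hμ
  have h1 := hf.fderiv_comp_mem_P2plus hV hVO hπμ
    (fun q hq => by rw [hPμ q hq]; exact ⟨π, rfl⟩) hq hw
  have h2 : fderiv ℝ (fun q => π.comp (μ q)) q w = π.comp (fderiv ℝ μ q w) := by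
    rw [((hasFDerivAt_const π q).clm_comp hμd.hasFDerivAt).fderiv]
    simp
  rw [h2, hPμ q hq] at h1
  obtain ⟨c, hc⟩ := h1
  have h3 : c.comp (μ q) = π.comp (fderiv ℝ μ q w) :=
    pullForm_injective (hf.surjective (hVO hq)) hc
  -- The derivative of row i along w is a combination c of the rows of μ; composing with M turns it
  -- into c on one side and 0 on the other.
  have h4 : c = 0 := by
    have h5 := congrArg (fun A => ContinuousLinearMap.comp A M) h3
    simp only [ContinuousLinearMap.comp_assoc, hμM q hq, hDM] at h5
    simpa using h5
  rw [h4] at h3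
  simpa [π] using (DFunLike.congr_fun h3 y).symm

/-- In coordinates (κ, f) the fibres of f are slices of a box. The normalized coefficients are
constant on each slice, hence are functions of f; freezing the κ-coordinate at its central value
gives them as smooth functions on f(W). -/
theorem IsSystemAround.exists_P2 (hf : IsSystemAround f O x₀ u₀) {d : ℕ}
    (hplus : IsCodistributionOn O d (P2plus f O)) : ∃ W P₂, IsP2 f O x₀ u₀ W P₂ := by
  obtain ⟨V, hV, hpV, hVO, μ, hμ, hPμ, hDμ⟩ := hf.exists_normalized hplus hf.mem
  obtain ⟨κ, hκ⟩ := exists_bijective_prod rfl (hf.surjective hf.mem)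
  let g := fun p => (κ p, f p)
  have hgd : ∀ q ∈ V, HasFDerivAt g (κ.prod (fderiv ℝ f q)) q := fun q hq =>
    κ.hasFDerivAt.prodMk (hf.differentiableAt (hVO hq)).hasFDerivAt
  obtain ⟨e, he, heg, heV, ⟨ε, hε, htgt⟩, -⟩ := exists_diffeoAround_ball (g := g)
    hV hpV (κ.contDiff.contDiffOn.prodMk (hf.smooth.mono hVO))
    (by rw [(hgd _ hpV).fderiv]; exact hκ)
  obtain ⟨hpe, -, hesymm⟩ := id he
  let c := g (x₀, u₀)
  have hfe : ∀ y ∈ e.target, f (e.symm y) = y.2 := fun y hy => by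
    have := e.right_inv hy
    rw [heg] at this
    exact congrArg Prod.snd this
  have hball : Metric.ball c ε = Metric.ball c.1 ε ×ˢ Metric.ball c.2 ε :=
    (ball_prod_same c.1 c.2 ε).symm
  have hconst : ∀ a a' b, (a, b) ∈ e.target → (a', b) ∈ e.target →
      μ (e.symm (a, b)) = μ (e.symm (a', b)) := by
    intro a a' b h h'
    have hd : ∀ y ∈ e.target, HasFDerivAt (fun y => μ (e.symm y))
        ((fderiv ℝ μ (e.symm y)).comp (fderiv ℝ e.symm y)) y := fun y hy =>
      ((hμ.contDiffAt (hV.mem_nhds (heV (e.map_target hy)))).differentiableAt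
        (by simp)).hasFDerivAt.comp y (he.hasFDerivAt_symm hy)
    have hconv : Convex ℝ e.target := htgt ▸ convex_ball _ _
    refine hconv.eq_of_fderiv_sub_eq_zero (g := fun y => μ (e.symm y))
      (fun y hy => (hd y hy).differentiableAt) h' h (fun y hy => ?_)
    rw [(hd y hy).fderiv]
    refine hDμ _ (heV (e.map_target hy)) _ ?_
    have h1 : HasFDerivAt (fun y => f (e.symm y))
        ((fderiv ℝ f (e.symm y)).comp (fderiv ℝ e.symm y)) y :=
      (hf.differentiableAt (hVO (heV (e.map_target hy)))).hasFDerivAt.comp y (he.hasFDerivAt_symm hy)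
    have h2 : HasFDerivAt (fun y => f (e.symm y)) (ContinuousLinearMap.snd ℝ _ _) y :=
      hasFDerivAt_snd.congr_of_eventuallyEq
        ((e.open_target.eventually_mem hy).mono hfe)
    have h3 := DFunLike.congr_fun (h1.unique h2) ((a, b) - (a', b))
    simpa using h3
  have himg : ∀ y ∈ f '' e.source, (c.1, y) ∈ e.target := by
    rintro _ ⟨q, hq, rfl⟩
    have h1 := e.map_source hq
    rw [heg, htgt, hball] at h1
    rw [htgt, hball]
    exact ⟨Metric.mem_ball_self hε, h1.2⟩
  let θ := fun y => μ (e.symm (c.1, y))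
  have hθ : ContDiffOn ℝ ∞ θ (f '' e.source) := by
    refine hμ.comp (hesymm.comp (contDiffOn_const.prodMk contDiffOn_id) himg) ?_
    exact fun y hy => heV (e.map_target (himg y hy))
  have hθμ : ∀ q ∈ e.source, θ (f q) = μ q := by
    intro q hq
    have h1 := e.map_source hq
    have h2 := e.left_inv hq
    rw [heg] at h1 h2
    have h3 := hconst c.1 (κ q) (f q) (himg _ ⟨q, hq, rfl⟩) h1
    simp only [θ, h3]
    exact congrArg μ h2
  let η : Fin d → (Fin n → ℝ) → ((Fin n → ℝ) →L[ℝ] ℝ) := fun j y =>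
    (ContinuousLinearMap.proj (R := ℝ) (φ := fun _ : Fin d => ℝ) j).comp (θ y)
  refine ⟨e.source, fun p => Submodule.span ℝ (Set.range fun j => (η j p.1).comp
        (ContinuousLinearMap.fst ℝ (Fin n → ℝ) (Fin m → ℝ))), e.open_source, hpe,
    heV.trans hVO, d, η, fun j => contDiffOn_const.clm_comp hθ, fun p hp => ?_, fun p _ => rfl⟩
  rw [hPμ p (heV hp), ← span_range_proj_comp]
  simp only [η, hθμ p hp]
  rfl

end System

/-! ### Dimension counts -/

section Dimension

variable {E F : Type*} [NormedAddCommGroup E] [NormedSpace ℝ E]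
  [NormedAddCommGroup F] [NormedSpace ℝ F]

/-- Generators forming a basis at p stay independent nearby, since independence is an open
condition, and by the constant dimension they still span. -/
theorem isCodistributionOn_of_finrank_eq {O : Set E} (hO : IsOpen O) {k d : ℕ}
    {η : Fin k → E → (E →L[ℝ] ℝ)} {P : E → Submodule ℝ (E →L[ℝ] ℝ)}
    (hη : ∀ j, ContDiffOn ℝ ∞ (η j) O)
    (hP : ∀ p ∈ O, P p = Submodule.span ℝ (Set.range fun j => η j p))
    (hd : ∀ p ∈ O, Module.finrank ℝ (P p) = d) : IsCodistributionOn O d P := by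
  intro p hp
  have hdp := hd p hp
  rw [hP p hp] at hdp
  subst hdp
  have := FiniteDimensional.span_of_finite ℝ (Set.finite_range fun j => η j p)
  obtain ⟨l, hl, -, hlin⟩ :=
    Submodule.exists_fun_fin_finrank_span_eq ℝ (Set.range fun j => η j p)
  choose σ hσ using hl
  have hσ' : l = fun i => η (σ i) p := funext fun i => (hσ i).symm
  rw [hσ'] at hlin
  have hcont : ContinuousOn (fun q => fun i => η (σ i) q) O :=
    continuousOn_pi.2 fun i => (hη (σ i)).continuousOn
  refine ⟨_, hcont.isOpen_inter_preimage hO isOpen_setOfPred_linearIndependent, ⟨hp, hlin⟩,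
    Set.inter_subset_left, fun i => η (σ i), fun i => (hη (σ i)).mono Set.inter_subset_left,
    fun q hq => ⟨hq.2, ?_⟩⟩
  have hle : Submodule.span ℝ (Set.range fun i => η (σ i) q) ≤ P q := by
    rw [hP q hq.1]
    exact Submodule.span_mono (Set.range_subset_iff.2 fun i => ⟨σ i, rfl⟩)
  have hfd : FiniteDimensional ℝ (P q) := by
    rw [hP q hq.1]
    exact FiniteDimensional.span_of_finite ℝ (Set.finite_range _)
  refine (Submodule.eq_of_le_of_finrank_eq hle ?_).symm
  rw [hd q hq.1, finrank_span_eq_card (b := fun i => η (σ i) q) hq.2, Fintype.card_fin]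

theorem IsCodistributionOn.finrank_eq {O : Set E} {d : ℕ} {P : E → Submodule ℝ (E →L[ℝ] ℝ)}
    (h : IsCodistributionOn O d P) {p : E} (hp : p ∈ O) : Module.finrank ℝ (P p) = d := by
  obtain ⟨V, -, hpV, -, η, -, hη⟩ := h p hp
  rw [(hη p hpV).2, finrank_span_eq_card (hη p hpV).1, Fintype.card_fin]

theorem finrank_ker_pullForm_add [FiniteDimensional ℝ F] (C : E →L[ℝ] F) :
    Module.finrank ℝ (LinearMap.ker (pullForm C)) + Module.finrank ℝ (LinearMap.range C.toLinearMap)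
      = Module.finrank ℝ F := by
  have h : LinearMap.ker (pullForm C) = (LinearMap.range C.toLinearMap).dualAnnihilator.map
      (LinearMap.toContinuousLinearMap : (F →ₗ[ℝ] ℝ) ≃ₗ[ℝ] (F →L[ℝ] ℝ)).toLinearMap := by
    ext l
    constructor
    · intro hl
      refine ⟨l.toLinearMap, ?_, by ext; rfl⟩
      rw [SetLike.mem_coe, Submodule.mem_dualAnnihilator]
      rintro _ ⟨x, rfl⟩
      exact DFunLike.congr_fun (show l.comp C = 0 from hl) x
    · rintro ⟨l, hl, rfl⟩
      rw [SetLike.mem_coe, Submodule.mem_dualAnnihilator] at hl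
      rw [LinearMap.mem_ker]
      ext x
      exact hl _ ⟨x, rfl⟩
  rw [h, LinearEquiv.finrank_map_eq, add_comm]
  exact Subspace.finrank_add_finrank_dualAnnihilator_eq _

theorem finrank_map_pullForm {A : E →L[ℝ] F} (hA : Function.Surjective A)
    (N : Submodule ℝ (F →L[ℝ] ℝ)) :
    Module.finrank ℝ (N.map (pullForm A)) = Module.finrank ℝ N :=
  (Submodule.equivMapOfInjective _ (pullForm_injective hA) N).finrank_eq.symm

theorem finrank_range_pullForm {k : ℕ} {A : E →L[ℝ] (Fin k → ℝ)} (hA : Function.Surjective A) :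
    Module.finrank ℝ (LinearMap.range (pullForm A)) = k := by
  rw [LinearMap.finrank_range_of_inj (pullForm_injective hA),
    ← (LinearMap.toContinuousLinearMap : ((Fin k → ℝ) →ₗ[ℝ] ℝ) ≃ₗ[ℝ] _).finrank_eq]
  simp

end Dimension

/-! ### The coefficient field of P₂ and its exact generators -/

section System

variable {n m : ℕ} {f : (Fin n → ℝ) × (Fin m → ℝ) → (Fin n → ℝ)}
  {O : Set ((Fin n → ℝ) × (Fin m → ℝ))} {x₀ : Fin n → ℝ} {u₀ : Fin m → ℝ}

/-- The partial derivative of `f` with respect to `u`. -/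
noncomputable def inputDeriv (f : (Fin n → ℝ) × (Fin m → ℝ) → (Fin n → ℝ))
    (p : (Fin n → ℝ) × (Fin m → ℝ)) : (Fin m → ℝ) →L[ℝ] (Fin n → ℝ) :=
  (fderiv ℝ f p).comp (ContinuousLinearMap.inr ℝ _ _)

theorem inputDeriv_apply (p : (Fin n → ℝ) × (Fin m → ℝ)) (u : Fin m → ℝ) :
    inputDeriv f p u = fderiv ℝ f p (0, u) := rfl

/-- Since df is onto, P₁ ∩ span{df} has the dimension of the annihilator of im ∂_u f, which is n
minus the rank. -/
theorem IsSystemAround.exists_rank (hf : IsSystemAround f O x₀ u₀) {c : ℕ}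
    (hcap : IsCodistributionOn O c (P1 n m ⊓ dspan f)) :
    ∃ r, ∀ p ∈ O, Module.finrank ℝ (LinearMap.range (inputDeriv f p).toLinearMap) = r := by
  refine ⟨n - c, fun p hp => ?_⟩
  have h1 := finrank_ker_pullForm_add (inputDeriv f p)
  have h2 : (P1 n m ⊓ dspan f) p =
      (LinearMap.ker (pullForm (inputDeriv f p))).map (pullForm (fderiv ℝ f p)) := by
    ext ζ
    rw [hf.mem_inf_iff hp]
    constructor
    · rintro ⟨l, hl, rfl⟩
      exact ⟨l, ContinuousLinearMap.ext hl, rfl⟩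
    · rintro ⟨l, hl, rfl⟩
      exact ⟨l, fun u => DFunLike.congr_fun (show l.comp (inputDeriv f p) = 0 from hl) u, rfl⟩
  have h3 := hcap.finrank_eq hp
  rw [h2, finrank_map_pullForm (hf.surjective hp)] at h3
  rw [h3, Module.finrank_fin_fun] at h1
  omega

/-- A form annihilating the image of `∂_u f` at `p` is the differential of a function, the
differential of which annihilates the image of `∂_u f` at nearby points. -/
theorem IsSystemAround.exists_potential (hf : IsSystemAround f O x₀ u₀) {r : ℕ}
    (hr : ∀ p ∈ O, Module.finrank ℝ (LinearMap.range (inputDeriv f p).toLinearMap) = r)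
    {W : Set ((Fin n → ℝ) × (Fin m → ℝ))} (hW : IsOpen W) (hWO : W ⊆ O)
    {p : (Fin n → ℝ) × (Fin m → ℝ)} (hp : p ∈ W) {l : (Fin n → ℝ) →L[ℝ] ℝ}
    (hl : ∀ u, l (fderiv ℝ f p (0, u)) = 0) :
    ∃ V, IsOpen V ∧ f p ∈ V ∧ ∃ h : (Fin n → ℝ) → ℝ, ContDiffOn ℝ ∞ h V ∧
      fderiv ℝ h (f p) = l ∧ ∀ y ∈ V, fderiv ℝ h y ∈ fibreForms f W y := by
  -- The affine section z ↦ p + L z is chosen so that directions in im ∂_u f(p) lift to pure input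
  -- directions. Then G = f ∘ j is a local diffeomorphism and l ∘ G⁻¹ is the potential.
  obtain ⟨L, hL, hL0⟩ := exists_adapted_rightInverse (hf.surjective (hWO hp))
  let j : (Fin n → ℝ) → (Fin n → ℝ) × (Fin m → ℝ) := fun z => p + L z
  have hj : ContDiff ℝ ∞ j := contDiff_const.add L.contDiff
  have hjd : ∀ z, HasFDerivAt j L z := fun z => L.hasFDerivAt.const_add p
  have hj0 : j 0 = p := by simp [j]
  let G := fun z => f (j z)
  have hGd : ∀ z ∈ j ⁻¹' W, HasFDerivAt G ((fderiv ℝ f (j z)).comp L) z := fun z hz =>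
    (hf.differentiableAt (hWO hz)).hasFDerivAt.comp z (hjd z)
  have h0 : (0 : Fin n → ℝ) ∈ j ⁻¹' W := by rw [Set.mem_preimage, hj0]; exact hp
  have hG0 : fderiv ℝ G 0 = ContinuousLinearMap.id ℝ _ := by
    rw [(hGd 0 h0).fderiv, hj0, hL]
  obtain ⟨e, he, heG, heW, -, hbij⟩ := exists_diffeoAround_ball (g := G)
    (hW.preimage hj.continuous) h0 (hf.smooth.comp hj.contDiffOn fun z hz => hWO hz)
    (by rw [hG0]; exact Function.bijective_id)
  obtain ⟨h0e, -, hesymm⟩ := id he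
  have hinv : ∀ z ∈ e.source,
      (fderiv ℝ e.symm (G z)).comp (fderiv ℝ G z) = ContinuousLinearMap.id ℝ _ := fun z hz =>
    ContinuousLinearMap.ext fun w => by
      have := he.fderiv_symm_fderiv hz w
      rwa [heG] at this
  have hhd : ∀ y ∈ e.target, fderiv ℝ (fun y => l (e.symm y)) y = l.comp (fderiv ℝ e.symm y) :=
    fun y hy => (l.hasFDerivAt.comp y (he.hasFDerivAt_symm hy)).fderiv
  have hGp : G 0 = f p := by simp only [G, hj0]
  have hpt : f p ∈ e.target := by
    have := e.map_source h0e
    rwa [heG, hGp] at this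
  refine ⟨e.target, e.open_target, hpt, fun y => l (e.symm y), l.contDiff.comp_contDiffOn hesymm,
    ?_, fun y hy => ?_⟩
  · have := hinv 0 h0e
    rw [hG0, ContinuousLinearMap.comp_id, hGp] at this
    rw [hhd _ hpt, this, ContinuousLinearMap.comp_id]
  · have hz : e.symm y ∈ e.source := e.map_target hy
    set z := e.symm y with hzdef
    have hGz : G z = y := by
      have := e.right_inv hy
      rwa [heG] at this
    refine Submodule.subset_span ⟨j z, heW hz, hGz, fun u => ?_⟩
    -- dG(z) carries im ∂_u f(p) into im ∂_u f(j z), and onto it by equality of ranks; so dh, which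
    -- undoes dG before applying l, annihilates the latter.
    have hle : (LinearMap.range (inputDeriv f p).toLinearMap).map (fderiv ℝ G z).toLinearMap ≤
        LinearMap.range (inputDeriv f (j z)).toLinearMap := by
      rintro _ ⟨_, ⟨u', rfl⟩, rfl⟩
      refine ⟨(L (fderiv ℝ f p (0, u'))).2, ?_⟩
      have h1 : L (fderiv ℝ f p (0, u')) = (0, (L (fderiv ℝ f p (0, u'))).2) :=
        Prod.ext (hL0 u') rfl
      rw [(hGd z (heW hz)).fderiv]
      change fderiv ℝ f (j z) (0, (L (fderiv ℝ f p (0, u'))).2)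
        = fderiv ℝ f (j z) (L (fderiv ℝ f p (0, u')))
      rw [← h1]
    have heq := Submodule.eq_of_le_of_finrank_eq hle (by
      rw [hr _ (hWO (heW hz)), ← hr p (hWO hp)]
      exact (Submodule.equivMapOfInjective (fderiv ℝ G z).toLinearMap (hbij z hz).1
        _).finrank_eq.symm)
    have hmem : fderiv ℝ f (j z) (0, u) ∈
        LinearMap.range (inputDeriv f (j z)).toLinearMap := ⟨u, rfl⟩
    rw [← heq] at hmem
    obtain ⟨_, ⟨u', rfl⟩, hu'⟩ := hmem
    have h2 := DFunLike.congr_fun (hinv z hz) (fderiv ℝ f p (0, u'))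
    rw [hGz] at h2
    change fderiv ℝ e.symm y (fderiv ℝ G z (fderiv ℝ f p (0, u'))) = _ at h2
    change fderiv ℝ G z (fderiv ℝ f p (0, u')) = _ at hu'
    rw [hhd y hy, ← hu', ContinuousLinearMap.comp_apply, h2]
    exact hl u'

/-- The data of the backward-shift: `N y` is the span at `y` of the coefficients of `P₂`. -/
structure IsShiftField (f : (Fin n → ℝ) × (Fin m → ℝ) → (Fin n → ℝ))
    (O W : Set ((Fin n → ℝ) × (Fin m → ℝ))) (d : ℕ)
    (N : (Fin n → ℝ) → Submodule ℝ ((Fin n → ℝ) →L[ℝ] ℝ)) : Prop where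
  isOpen : IsOpen W
  subset : W ⊆ O
  map_eq : ∀ p ∈ W, P2plus f O p = (N (f p)).map (pullForm (fderiv ℝ f p))
  finrank_eq : ∀ y ∈ f '' W, Module.finrank ℝ (N y) = d

theorem IsShiftField.fibreForms_le (hf : IsSystemAround f O x₀ u₀)
    {W : Set ((Fin n → ℝ) × (Fin m → ℝ))} {d : ℕ}
    {N : (Fin n → ℝ) → Submodule ℝ ((Fin n → ℝ) →L[ℝ] ℝ)} (hN : IsShiftField f O W d N)
    (y : Fin n → ℝ) : fibreForms f W y ≤ N y := by
  refine Submodule.span_le.2 ?_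
  rintro l ⟨p, hp, rfl, hl⟩
  have h1 := hf.comp_mem_P2plus (hN.subset hp) hl
  rw [hN.map_eq p hp] at h1
  obtain ⟨l', hl', h2⟩ := h1
  rwa [← pullForm_injective (hf.surjective (hN.subset hp)) h2]

/-- The reverse inclusion is the minimality of P₂⁺; pullback by the surjective df is injective on
coefficients, so they can be compared directly. -/
theorem IsShiftField.fibreForms_eq (hf : IsSystemAround f O x₀ u₀)
    {W : Set ((Fin n → ℝ) × (Fin m → ℝ))} {d : ℕ}
    {N : (Fin n → ℝ) → Submodule ℝ ((Fin n → ℝ) →L[ℝ] ℝ)} (hN : IsShiftField f O W d N)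
    {y : Fin n → ℝ} (hy : y ∈ f '' W) : fibreForms f W y = N y := by
  refine le_antisymm (hN.fibreForms_le hf y) ?_
  obtain ⟨p, hp, rfl⟩ := hy
  have h1 := hf.P2plus_le hN.isOpen hN.subset hp
  rw [hN.map_eq p hp] at h1
  exact (Submodule.map_le_map_iff_of_injective
    (pullForm_injective (hf.surjective (hN.subset hp))) _ _).1 h1

theorem IsP2.exists_shiftField (hf : IsSystemAround f O x₀ u₀) {d : ℕ}
    (hplus : IsCodistributionOn O d (P2plus f O)) {W : Set ((Fin n → ℝ) × (Fin m → ℝ))}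
    {P₂ : (Fin n → ℝ) × (Fin m → ℝ) → Submodule ℝ ((Fin n → ℝ) × (Fin m → ℝ) →L[ℝ] ℝ)}
    (h : IsP2 f O x₀ u₀ W P₂) :
    ∃ N, IsShiftField f O W d N ∧
      (∀ p ∈ shiftDomain f W, P₂ p =
        (N p.1).map (pullForm (ContinuousLinearMap.fst ℝ (Fin n → ℝ) (Fin m → ℝ)))) ∧
      IsCodistributionOn (shiftDomain f W) d P₂ := by
  obtain ⟨hW, -, hWO, k, η, hη, hQ, hR⟩ := h
  let N := fun y => Submodule.span ℝ (Set.range fun j => η j y)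
  have hmap : ∀ p ∈ W, P2plus f O p = (N (f p)).map (pullForm (fderiv ℝ f p)) := by
    intro p hp
    rw [hQ p hp, Submodule.map_span, ← Set.range_comp]
    rfl
  have hfin : ∀ y ∈ f '' W, Module.finrank ℝ (N y) = d := by
    rintro _ ⟨p, hp, rfl⟩
    rw [← finrank_map_pullForm (hf.surjective (hWO hp)), ← hmap p hp]
    exact hplus.finrank_eq (hWO hp)
  have hR' : ∀ p ∈ shiftDomain f W, P₂ p =
      (N p.1).map (pullForm (ContinuousLinearMap.fst ℝ (Fin n → ℝ) (Fin m → ℝ))) := by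
    intro p hp
    rw [hR p hp, Submodule.map_span, ← Set.range_comp]
    rfl
  refine ⟨N, ⟨hW, hWO, hmap, hfin⟩, hR', ?_⟩
  have hopen : IsOpen (shiftDomain f W) := (hf.isOpen_image hW hWO).preimage continuous_fst
  refine isCodistributionOn_of_finrank_eq hopen (η := fun j p => (η j p.1).comp
    (ContinuousLinearMap.fst ℝ (Fin n → ℝ) (Fin m → ℝ))) (fun j => ?_) hR fun p hp => ?_
  · exact ((hη j).comp contDiffOn_fst fun p hp => hp).clm_comp contDiffOn_const
  · rw [hR' p hp, finrank_map_pullForm Prod.fst_surjective]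
    exact hfin _ hp

theorem isCodistributionOn_P1 {V : Set ((Fin n → ℝ) × (Fin m → ℝ))} (hV : IsOpen V) :
    IsCodistributionOn V n (P1 n m) := by
  refine isCodistributionOn_of_finrank_eq hV (η := fun i => fderiv ℝ fun q => q.1 i)
    (fun i => ?_) (fun p _ => rfl) fun p _ => ?_
  · have : (fderiv ℝ fun q : (Fin n → ℝ) × (Fin m → ℝ) => q.1 i) = fun _ =>
        (ContinuousLinearMap.proj (R := ℝ) (φ := fun _ : Fin n => ℝ) i).comp
          (ContinuousLinearMap.fst ℝ _ _) := funext fun p => by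
      exact ((ContinuousLinearMap.proj (R := ℝ) (φ := fun _ : Fin n => ℝ) i).comp
          (ContinuousLinearMap.fst ℝ (Fin n → ℝ) (Fin m → ℝ))).hasFDerivAt.fderiv
    rw [this]
    exact contDiffOn_const
  · rw [P1, dspan_eq_range differentiableAt_fst, fderiv_fst]
    exact finrank_range_pullForm Prod.fst_surjective

end System

/-! ### The triangular form: necessity, straightening, completion -/

section System

variable {n m : ℕ} {f : (Fin n → ℝ) × (Fin m → ℝ) → (Fin n → ℝ)}
  {O : Set ((Fin n → ℝ) × (Fin m → ℝ))} {x₀ : Fin n → ℝ} {u₀ : Fin m → ℝ}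

/-- Varying ū₁ alone fixes x and x̄₂⁺ and moves x̄₁⁺ in every direction. So at every point of the
chart over x₀ the image of ∂_u f contains the same nonzero vector w, every fibre form at x₀ kills w,
and at least one dimension is lost. -/
theorem IsTriangularForm.finrank_lt (hf : IsSystemAround f O x₀ u₀) {n₁ n₂ m₁ m₂ : ℕ}
    {Φ : OpenPartialHomeomorph (Fin n → ℝ) ((Fin n₁ → ℝ) × (Fin n₂ → ℝ))}
    {Ψ : OpenPartialHomeomorph ((Fin n → ℝ) × (Fin m → ℝ))
      (((Fin n₁ → ℝ) × (Fin n₂ → ℝ)) × ((Fin m₁ → ℝ) × (Fin m₂ → ℝ)))}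
    (h : IsTriangularForm f O x₀ u₀ Φ Ψ) :
    Module.finrank ℝ (P2plus f O (x₀, u₀)) < n := by
  obtain ⟨f₂, f₁, -, -, hform, hrank⟩ := h.form
  have hΨ := h.diffeo
  have hΦ := h.state_diffeo
  have hWO : Ψ.source ⊆ O := fun p hp => (h.domain p hp).1
  -- Any nonzero vector would do; one exists because n₁ ≥ 1.
  let a₀ : Fin n₁ → ℝ := fun _ => 1
  let w := fderiv ℝ Φ.symm (Φ x₀) (a₀, 0)
  have hw : w ≠ 0 := by
    intro hw
    have h1 := hΦ.fderiv_fderiv_symm hΦ.1 (a₀, 0)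
    change fderiv ℝ Φ x₀ w = _ at h1
    rw [hw, map_zero] at h1
    have h2 := congrFun (congrArg Prod.fst h1) (⟨0, h.dim_pos⟩ : Fin n₁)
    simp [a₀] at h2
  have hkill : fibreForms f Ψ.source x₀ ≤
      LinearMap.ker (pullForm (ContinuousLinearMap.toSpanSingleton ℝ w)) := by
    refine Submodule.span_le.2 ?_
    rintro l ⟨p, hp, hfp, hl⟩
    suffices ∃ u, fderiv ℝ f p (0, u) = w by
      obtain ⟨u, hu⟩ := this
      rw [SetLike.mem_coe, LinearMap.mem_ker]
      ext
      simpa [← hu] using hl u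
    have hq := Ψ.map_source hp
    set q := Ψ p with hqdef
    have hpq : Ψ.symm q = p := Ψ.left_inv hp
    let ι : (Fin m₁ → ℝ) → ((Fin n₁ → ℝ) × (Fin n₂ → ℝ)) × ((Fin m₁ → ℝ) × (Fin m₂ → ℝ)) :=
      fun v => (q.1, (v, q.2.2))
    have hιd : HasFDerivAt ι ((ContinuousLinearMap.inr ℝ _ _).comp
        (ContinuousLinearMap.inl ℝ _ _)) q.2.1 :=
      (hasFDerivAt_prodMk_right q.1 q.2).comp q.2.1 (hasFDerivAt_prodMk_left q.2.1 q.2.2)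
    have hι : ∀ᶠ v in 𝓝 q.2.1, ι v ∈ Ψ.target :=
      hιd.continuousAt.eventually (Ψ.open_target.eventually_mem hq)
    let c := fun v => Ψ.symm (ι v)
    obtain ⟨D, hcd⟩ : ∃ D, HasFDerivAt c D q.2.1 :=
      ⟨_, (hΨ.hasFDerivAt_symm (y := ι q.2.1) hq).comp q.2.1 hιd⟩
    have hc1 : ∀ᶠ v in 𝓝 q.2.1, (c v).1 = p.1 := by
      filter_upwards [hι] with v hv
      have hcv := Ψ.map_target hv
      refine Φ.injOn (h.domain _ hcv).2.1 (h.domain _ hp).2.1 ?_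
      rw [← h.state _ hcv, ← h.state _ hp, Ψ.right_inv hv]
    have hfc : ∀ᶠ v in 𝓝 q.2.1, (f₁ (q.1.2, q.1.1, q.2.2, v), f₂ (q.1.2, q.1.1, q.2.2))
        = Φ (f (c v)) := by
      filter_upwards [hι] with v hv
      have hcv := Ψ.map_target hv
      have h1 := hform _ hcv
      rw [Ψ.right_inv hv] at h1
      exact Prod.ext h1.2.symm h1.1.symm
    have hcq : c q.2.1 = p := hpq
    have hpO := hWO hp
    have hfcd : HasFDerivAt (fun v => f (c v)) ((fderiv ℝ f p).comp D) q.2.1 := by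
      have h1 : HasFDerivAt f (fderiv ℝ f p) (c q.2.1) := by
        rw [hcq]; exact (hf.differentiableAt hpO).hasFDerivAt
      exact h1.comp q.2.1 hcd
    have hΦfc : HasFDerivAt (fun v => Φ (f (c v)))
        ((fderiv ℝ Φ x₀).comp ((fderiv ℝ f p).comp D)) q.2.1 := by
      have h1 : HasFDerivAt Φ (fderiv ℝ Φ x₀) (f (c q.2.1)) := by
        rw [hcq, hfp]; exact hΦ.hasFDerivAt hΦ.1
      exact h1.comp q.2.1 hfcd
    have hF := hΦfc.congr_of_eventuallyEq hfc
    have hF1 := hF.fst.fderiv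
    have hF2 := hF.snd.unique (hasFDerivAt_const _ _)
    have hsurj := LinearMap.range_eq_top.1 (Submodule.eq_top_of_finrank_eq
      ((hrank q hq).trans (Module.finrank_fin_fun ℝ).symm))
    obtain ⟨a, ha⟩ := hsurj a₀
    have hD1 : (D a).1 = 0 := by
      have h1 := hcd.fst.unique ((hasFDerivAt_const p.1 q.2.1).congr_of_eventuallyEq hc1)
      exact DFunLike.congr_fun h1 a
    refine ⟨(D a).2, ?_⟩
    have h1 : ((0 : Fin n → ℝ), (D a).2) = D a := Prod.ext hD1.symm rfl
    have h2 : fderiv ℝ Φ x₀ (fderiv ℝ f p (D a)) = (a₀, 0) := by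
      refine Prod.ext ?_ (DFunLike.congr_fun hF2 a)
      rw [← ha]
      exact (DFunLike.congr_fun hF1 a).symm
    rw [h1, ← hΦ.fderiv_symm_fderiv hΦ.1 (fderiv ℝ f p (D a)), h2]
  have hle := hf.P2plus_le Ψ.open_source hWO hΨ.1
  rw [hf.equilibrium] at hle
  have h1 := Submodule.finrank_mono (hle.trans (Submodule.map_mono hkill))
  rw [finrank_map_pullForm (hf.surjective hf.mem)] at h1
  have h2 := finrank_ker_pullForm_add (ContinuousLinearMap.toSpanSingleton ℝ w)
  have h3 : LinearMap.range (ContinuousLinearMap.toSpanSingleton ℝ w).toLinearMap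
      = Submodule.span ℝ {w} := (LinearMap.span_singleton_eq_range ℝ _ w).symm
  rw [h3, finrank_span_singleton hw, Module.finrank_fin_fun] at h2
  omega

/-- A basis of N(x₀) can be picked among forms that each annihilate im ∂_u f at a single point over
x₀. Each has a potential with differential in N, and by dimension these d differentials span N
nearby; the potentials serve as x̄₂. -/
theorem IsShiftField.exists_straightening (hf : IsSystemAround f O x₀ u₀) {r : ℕ}
    (hr : ∀ p ∈ O, Module.finrank ℝ (LinearMap.range (inputDeriv f p).toLinearMap) = r)
    {W : Set ((Fin n → ℝ) × (Fin m → ℝ))} {d : ℕ}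
    {N : (Fin n → ℝ) → Submodule ℝ ((Fin n → ℝ) →L[ℝ] ℝ)} (hN : IsShiftField f O W d N)
    (hW : (x₀, u₀) ∈ W) :
    ∃ (Φ : OpenPartialHomeomorph (Fin n → ℝ) ((Fin (n - d) → ℝ) × (Fin d → ℝ))),
      IsDiffeoAround Φ x₀ ∧
      ∀ᶠ y in 𝓝 x₀, N y = LinearMap.range (pullForm (fderiv ℝ (fun y => (Φ y).2) y)) := by
  have hx₀ : x₀ ∈ f '' W := ⟨_, hW, hf.equilibrium⟩
  obtain ⟨l, hl, hlin⟩ : ∃ l : Fin d → ((Fin n → ℝ) →L[ℝ] ℝ),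
      (∀ i, ∃ p ∈ W, f p = x₀ ∧ ∀ u, l i (fderiv ℝ f p (0, u)) = 0) ∧ LinearIndependent ℝ l := by
    have hd := hN.finrank_eq x₀ hx₀
    rw [← hN.fibreForms_eq hf hx₀] at hd
    subst hd
    obtain ⟨l, hl, -, hlin⟩ := Submodule.exists_fun_fin_finrank_span_eq ℝ
      {l : (Fin n → ℝ) →L[ℝ] ℝ | ∃ p ∈ W, f p = x₀ ∧ ∀ u, l (fderiv ℝ f p (0, u)) = 0}
    exact ⟨l, hl, hlin⟩
  have hpot : ∀ i, ∃ V, IsOpen V ∧ x₀ ∈ V ∧ ∃ h : (Fin n → ℝ) → ℝ, ContDiffOn ℝ ∞ h V ∧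
      fderiv ℝ h x₀ = l i ∧ ∀ y ∈ V, fderiv ℝ h y ∈ fibreForms f W y := by
    intro i
    obtain ⟨p, hp, hfp, hlp⟩ := hl i
    have := hf.exists_potential hr hN.isOpen hN.subset hp hlp
    rwa [hfp] at this
  choose V hV hxV h hh hhx hhV using hpot
  let V₀ := (⋂ i, V i) ∩ f '' W
  have hV₀ : IsOpen V₀ :=
    (isOpen_iInter_of_finite hV).inter (hf.isOpen_image hN.isOpen hN.subset)
  have hxV₀ : x₀ ∈ V₀ := ⟨Set.mem_iInter.2 hxV, hx₀⟩
  have hV₀V : ∀ y ∈ V₀, ∀ i, y ∈ V i := fun y hy => Set.mem_iInter.1 hy.1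
  let H : (Fin n → ℝ) → (Fin d → ℝ) := fun y i => h i y
  have hH : ContDiffOn ℝ ∞ H V₀ := contDiffOn_pi.2 fun i => (hh i).mono fun y hy => hV₀V y hy i
  have hHd : ∀ y ∈ V₀, HasFDerivAt H (ContinuousLinearMap.pi fun i => fderiv ℝ (h i) y) y :=
    fun y hy => hasFDerivAt_pi.2 fun i =>
      (((hh i).contDiffAt ((hV i).mem_nhds (hV₀V y hy i))).differentiableAt (by simp)).hasFDerivAt
  have hsurj : Function.Surjective (fderiv ℝ H x₀) := by
    rw [(hHd x₀ hxV₀).fderiv]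
    simp only [hhx]
    exact surjective_pi_of_linearIndependent hlin
  obtain ⟨κ, hκ⟩ := exists_bijective_prod (Module.finrank_fin_fun (n := n) ℝ) hsurj
  let g := fun y => (κ y, H y)
  have hgd : ∀ y ∈ V₀, HasFDerivAt g (κ.prod (fderiv ℝ H y)) y := fun y hy =>
    κ.hasFDerivAt.prodMk (hHd y hy).differentiableAt.hasFDerivAt
  obtain ⟨Φ, hΦ, hΦg, hΦV, -, hbij⟩ := exists_diffeoAround_ball (g := g) hV₀ hxV₀
    (κ.contDiff.contDiffOn.prodMk hH) (by rw [(hgd x₀ hxV₀).fderiv]; exact hκ)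
  refine ⟨Φ, hΦ, ?_⟩
  filter_upwards [Φ.open_source.mem_nhds hΦ.1] with y hy
  have hyV := hΦV hy
  have hsurjy : Function.Surjective (fderiv ℝ H y) := by
    intro b
    obtain ⟨x, hx⟩ := (hbij y hy).2 (0, b)
    rw [(hgd y hyV).fderiv] at hx
    exact ⟨x, congrArg Prod.snd hx⟩
  have hfun : (fun y => (Φ y).2) = H := by rw [hΦg]
  rw [hfun]
  have hle : LinearMap.range (pullForm (fderiv ℝ H y)) ≤ N y := by
    rw [(hHd y hyV).fderiv, ← span_range_eq_range_pullForm_pi]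
    refine Submodule.span_le.2 ?_
    rintro _ ⟨i, rfl⟩
    exact hN.fibreForms_le hf y (hhV i y (hV₀V y hyV i))
  refine (Submodule.eq_of_le_of_finrank_eq hle ?_).symm
  rw [finrank_range_pullForm hsurjy, hN.finrank_eq y hyV.2]

/-- Below, D = dx̄₂, g = x̄₂⁺ and C = ∂_u g. The annihilator of im ∂_u f lies in span{dx̄₂}; this
yields both the constant rank of C and the controllability of x̄₁⁺. -/
theorem IsShiftField.exists_completion (hf : IsSystemAround f O x₀ u₀) {r : ℕ}
    (hr : ∀ p ∈ O, Module.finrank ℝ (LinearMap.range (inputDeriv f p).toLinearMap) = r)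
    {W : Set ((Fin n → ℝ) × (Fin m → ℝ))} {d : ℕ}
    {N : (Fin n → ℝ) → Submodule ℝ ((Fin n → ℝ) →L[ℝ] ℝ)} (hN : IsShiftField f O W d N)
    (hW : (x₀, u₀) ∈ W) (hd : d < n)
    {Φ : OpenPartialHomeomorph (Fin n → ℝ) ((Fin (n - d) → ℝ) × (Fin d → ℝ))}
    (hΦ : IsDiffeoAround Φ x₀)
    (hst : ∀ᶠ y in 𝓝 x₀, N y = LinearMap.range (pullForm (fderiv ℝ (fun y => (Φ y).2) y))) :
    ∃ (m₁ m₂ : ℕ) (Ψ : OpenPartialHomeomorph ((Fin n → ℝ) × (Fin m → ℝ))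
      (((Fin (n - d) → ℝ) × (Fin d → ℝ)) × ((Fin m₁ → ℝ) × (Fin m₂ → ℝ)))),
      IsTriangularForm f O x₀ u₀ Φ Ψ := by
  obtain ⟨Y, hYst, hYo, hxY⟩ := eventually_nhds_iff.1 hst
  let U : Set ((Fin n → ℝ) × (Fin m → ℝ)) :=
    (W ∩ f ⁻¹' (Φ.source ∩ Y)) ∩ Prod.fst ⁻¹' Φ.source
  have hUO : U ⊆ O := fun p hp => hN.subset hp.1.1
  have hU : IsOpen U :=
    ((hf.smooth.mono hN.subset).continuousOn.isOpen_inter_preimage hN.isOpen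
      (Φ.open_source.inter hYo)).inter (Φ.open_source.preimage continuous_fst)
  have hpU : (x₀, u₀) ∈ U := by
    refine ⟨⟨hW, ?_⟩, hΦ.1⟩
    rw [Set.mem_preimage, hf.equilibrium]
    exact ⟨hΦ.1, hxY⟩
  let D : (Fin n → ℝ) → ((Fin n → ℝ) →L[ℝ] (Fin d → ℝ)) := fun y =>
    (ContinuousLinearMap.snd ℝ _ _).comp (fderiv ℝ Φ y)
  have hD : ∀ y ∈ Φ.source, HasFDerivAt (fun y => (Φ y).2) (D y) y := fun y hy =>
    (hΦ.hasFDerivAt hy).snd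
  have hDsurj : ∀ y ∈ Φ.source, Function.Surjective (D y) := fun y hy b =>
    ⟨fderiv ℝ Φ.symm (Φ y) (0, b), by simp [D, hΦ.fderiv_fderiv_symm hy]⟩
  have hND : ∀ p ∈ U, N (f p) = LinearMap.range (pullForm (D (f p))) := fun p hp => by
    rw [hYst _ hp.1.2.2, (hD _ hp.1.2.1).fderiv]
  have hker : ∀ p ∈ U, LinearMap.ker (pullForm (inputDeriv f p)) ≤
      LinearMap.range (pullForm (D (f p))) := fun p hp l hl => by
    rw [← hND p hp]
    exact hN.fibreForms_le hf _ (Submodule.subset_span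
      ⟨p, hp.1.1, rfl, fun u => DFunLike.congr_fun (show l.comp (inputDeriv f p) = 0 from hl) u⟩)
  -- Forms annihilating im ∂_u f factor through D and so kill ker D; by duality ker D lies in im ∂_u
  -- f.
  have hlift : ∀ p ∈ U, ∀ w, D (f p) w = 0 → ∃ u, inputDeriv f p u = w := fun p hp w hw =>
    mem_range_of_forall_dual fun l hl => by
      obtain ⟨c, rfl⟩ := hker p hp hl
      simp [hw]
  let C := fun p => (D (f p)).comp (inputDeriv f p)
  obtain ⟨ρ, hρ⟩ : ∃ ρ, ∀ p ∈ U, Module.finrank ℝ (LinearMap.range (C p).toLinearMap) = ρ := by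
    -- Pullback by D identifies the annihilator of im C, of dimension d - rank C, with that of im
    -- ∂_u f, of dimension n - r.
    refine ⟨d - (n - r), fun p hp => ?_⟩
    have h1 := finrank_ker_pullForm_add (C p)
    have h2 := finrank_ker_pullForm_add (inputDeriv f p)
    have h3 : LinearMap.ker (pullForm (inputDeriv f p)) =
        (LinearMap.ker (pullForm (C p))).map (pullForm (D (f p))) := by
      apply le_antisymm
      · intro l hl
        obtain ⟨c, rfl⟩ := hker p hp hl
        exact ⟨c, hl, rfl⟩
      · rintro _ ⟨c, hc, rfl⟩
        exact hc
    rw [h3, finrank_map_pullForm (hDsurj _ hp.1.2.1), hr p (hUO hp), Module.finrank_fin_fun] at h2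
    rw [Module.finrank_fin_fun] at h1
    omega
  obtain ⟨π, hπ⟩ : ∃ π : (Fin d → ℝ) →L[ℝ] (Fin ρ → ℝ),
      Function.Surjective (π.comp (C (x₀, u₀))) := by
    let R := LinearMap.range (C (x₀, u₀)).toLinearMap
    have eR : R ≃ₗ[ℝ] (Fin ρ → ℝ) :=
      LinearEquiv.ofFinrankEq _ _ ((hρ _ hpU).trans (Module.finrank_fin_fun ℝ).symm)
    obtain ⟨π, hπ⟩ := R.subtype.exists_leftInverse_of_injective (Submodule.ker_subtype _)
    refine ⟨LinearMap.toContinuousLinearMap (eR.toLinearMap.comp π), fun b => ?_⟩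
    obtain ⟨u, hu⟩ := (eR.symm b).2
    refine ⟨u, ?_⟩
    have h1 : π (C (x₀, u₀) u) = eR.symm b := by
      have := LinearMap.congr_fun hπ (eR.symm b)
      rw [LinearMap.comp_apply, Submodule.subtype_apply, ← hu] at this
      exact this
    change eR (π (C (x₀, u₀) u)) = b
    rw [h1, LinearEquiv.apply_symm_apply]
  obtain ⟨τ, hτ⟩ := exists_bijective_prod (Module.finrank_fin_fun (n := m) ℝ) hπ
  let g := fun p => (Φ (f p)).2
  have hgd : ∀ p ∈ U, HasFDerivAt g ((D (f p)).comp (fderiv ℝ f p)) p := fun p hp =>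
    (hD _ hp.1.2.1).comp p (hf.differentiableAt (hUO hp)).hasFDerivAt
  have hgs : ContDiffOn ℝ ∞ g U :=
    (hΦ.2.1.comp (hf.smooth.mono hUO) fun p hp => hp.1.2.1).snd
  -- The new inputs: ū₂ = π(x̄₂⁺) are ρ independent combinations of x̄₂⁺, and ū₁ = τ(u) completes
  -- them.
  let G := fun p : (Fin n → ℝ) × (Fin m → ℝ) => (Φ p.1, (τ p.2, π (g p)))
  have hGs : ContDiffOn ℝ ∞ G U :=
    (hΦ.2.1.comp contDiffOn_fst fun p hp => hp.2).prodMk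
      ((τ.contDiff.comp contDiff_snd).contDiffOn.prodMk (π.contDiff.comp_contDiffOn hgs))
  have hGd : ∀ p ∈ U, ∀ x u, fderiv ℝ G p (x, u) =
      (fderiv ℝ Φ p.1 x, (τ u, π (D (f p) (fderiv ℝ f p (x, u))))) := fun p hp x u => by
    have h1 : HasFDerivAt G (((fderiv ℝ Φ p.1).comp (ContinuousLinearMap.fst ℝ _ _)).prod
        ((τ.comp (ContinuousLinearMap.snd ℝ _ _)).prod
          (π.comp ((D (f p)).comp (fderiv ℝ f p))))) p :=
      ((hΦ.hasFDerivAt hp.2).comp p hasFDerivAt_fst).prodMk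
        ((τ.hasFDerivAt.comp p hasFDerivAt_snd).prodMk (π.hasFDerivAt.comp p (hgd p hp)))
    rw [h1.fderiv]
    rfl
  have hΦinj : ∀ y ∈ Φ.source, ∀ x, fderiv ℝ Φ y x = 0 → x = 0 := fun y hy x hx => by
    rw [← hΦ.fderiv_symm_fderiv hy x, hx, map_zero]
  have hG₀ : Function.Bijective (fderiv ℝ G (x₀, u₀)) := by
    constructor
    · rw [injective_iff_map_eq_zero]
      rintro ⟨x, u⟩ h
      rw [hGd _ hpU] at h
      obtain ⟨h1, h2⟩ := Prod.mk_eq_zero.1 h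
      obtain rfl := hΦinj _ hΦ.1 x h1
      have h3 : u = 0 := hτ.1 (by rw [map_zero]; exact h2)
      rw [h3]
      rfl
    · rintro ⟨y, a, b⟩
      let x := fderiv ℝ Φ.symm (Φ x₀) y
      obtain ⟨u, hu⟩ := hτ.2 (a, b - π (D (f (x₀, u₀)) (fderiv ℝ f (x₀, u₀) (x, 0))))
      obtain ⟨hu1, hu2⟩ := Prod.ext_iff.1 hu
      refine ⟨(x, u), ?_⟩
      rw [hGd _ hpU]
      refine Prod.ext (hΦ.fderiv_fderiv_symm hΦ.1 y) (Prod.ext hu1 ?_)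
      have h1 : ((x, u) : (Fin n → ℝ) × (Fin m → ℝ)) = (x, 0) + (0, u) := by simp
      change π (D (f (x₀, u₀)) (fderiv ℝ f (x₀, u₀) (0, u))) = _ at hu2
      change π (D (f (x₀, u₀)) (fderiv ℝ f (x₀, u₀) (x, u))) = b
      rw [h1, map_add, map_add, map_add, hu2]
      simp
  obtain ⟨Ψ, hΨ, hΨG, hΨU, ⟨ε, hε, htgt⟩, hbij⟩ := exists_diffeoAround_ball hU hpU hGs hG₀
  -- π ∘ C is onto ℝ^ρ and C has rank ρ, so their kernels agree: an input direction that fixes ū₂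
  -- infinitesimally fixes all of x̄₂⁺.
  have hCker : ∀ p ∈ Ψ.source, ∀ u, π (C p u) = 0 → C p u = 0 := by
    intro p hp
    have hsurj : Function.Surjective (π.comp (C p)) := fun b => by
      obtain ⟨⟨x, u⟩, h⟩ := (hbij p hp).2 (0, (0, b))
      rw [hGd p (hΨU hp)] at h
      obtain ⟨h1, h2⟩ := Prod.ext_iff.1 h
      obtain rfl := hΦinj _ (hΨU hp).2 x h1
      exact ⟨u, congrArg Prod.snd h2⟩
    have h1 := (C p).toLinearMap.finrank_range_add_finrank_ker
    have h2 := (π.comp (C p)).toLinearMap.finrank_range_add_finrank_ker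
    rw [hρ p (hΨU hp)] at h1
    rw [LinearMap.range_eq_top.2 hsurj, finrank_top, Module.finrank_fin_fun] at h2
    have h3 : LinearMap.ker (C p).toLinearMap ≤ LinearMap.ker (π.comp (C p)).toLinearMap :=
      fun u hu => by
        have hu' : C p u = 0 := hu
        change π (C p u) = 0
        rw [hu', map_zero]
    have h4 := Submodule.eq_of_le_of_finrank_eq h3 (by omega)
    intro u hu
    have : u ∈ LinearMap.ker (π.comp (C p)).toLinearMap := hu
    rw [← h4] at this
    exact this
  have hvert : ∀ q ∈ Ψ.target, ∀ a, ∃ u, fderiv ℝ Ψ.symm q (0, (a, 0)) = (0, u) ∧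
      C (Ψ.symm q) u = 0 := by
    intro q hq a
    have hp := Ψ.map_target hq
    have h1 := hΨ.fderiv_fderiv_symm hp (0, (a, 0))
    rw [Ψ.right_inv hq] at h1
    generalize fderiv ℝ Ψ.symm q (0, (a, 0)) = z at h1 ⊢
    obtain ⟨x, u⟩ := z
    rw [hΨG, hGd _ (hΨU hp)] at h1
    obtain ⟨h2, h3⟩ := Prod.ext_iff.1 h1
    obtain rfl := hΦinj _ (hΨU hp).2 x h2
    exact ⟨u, rfl, hCker _ hp u (congrArg Prod.snd h3)⟩
  let q₀ := G (x₀, u₀)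
  have hball : ∀ q ∈ Ψ.target, (q.1, (q₀.2.1, q.2.2)) ∈ Ψ.target := by
    intro q hq
    have h1 : Metric.ball q₀ ε = Metric.ball q₀.1 ε ×ˢ Metric.ball q₀.2.1 ε ×ˢ
        Metric.ball q₀.2.2 ε := by
      rw [ball_prod_same q₀.2.1 q₀.2.2, ball_prod_same q₀.1 q₀.2]
    change Ψ.target = Metric.ball q₀ ε at htgt
    rw [htgt, h1] at hq ⊢
    exact ⟨hq.1, Metric.mem_ball_self hε, hq.2.2⟩
  -- The target is a convex product of balls, so vanishing of the ū₁-derivative allows ū₁ to be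
  -- replaced by its central value; this defines f₂.
  have hindep : ∀ q ∈ Ψ.target, g (Ψ.symm q) = g (Ψ.symm (q.1, (q₀.2.1, q.2.2))) := by
    intro q hq
    have hgΨ : ∀ q ∈ Ψ.target, HasFDerivAt (fun q => g (Ψ.symm q)) _ q := fun q hq =>
      (hgd _ (hΨU (Ψ.map_target hq))).comp q (hΨ.hasFDerivAt_symm hq)
    have hconv : Convex ℝ Ψ.target := by rw [htgt]; exact convex_ball _ _
    refine Convex.eq_of_fderiv_sub_eq_zero hconv (g := fun q => g (Ψ.symm q))
      (fun q hq => (hgΨ q hq).differentiableAt) (hball q hq) hq fun q' hq' => ?_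
    rw [(hgΨ q' hq').fderiv]
    have h1 : q - (q.1, (q₀.2.1, q.2.2)) = (0, (q.2.1 - q₀.2.1, 0)) := by
      refine Prod.ext (sub_self _) (Prod.ext rfl (sub_self _))
    obtain ⟨u, hu, hCu⟩ := hvert q' hq' (q.2.1 - q₀.2.1)
    rw [h1, ContinuousLinearMap.comp_apply, hu]
    exact hCu
  refine ⟨m - ρ, ρ, Ψ, hΦ, hΨ,
    fun p hp => ⟨hUO (hΨU hp), (hΨU hp).2, (hΨU hp).1.2.1⟩,
    fun p hp => by rw [hΨG], by omega,
    fun w => g (Ψ.symm ((w.2.1, w.1), (q₀.2.1, w.2.2))),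
    fun w => (Φ (f (Ψ.symm ((w.2.1, w.1), (w.2.2.2, w.2.2.1))))).1, ?_, ?_, ?_, ?_⟩
  · refine hgs.comp (hΨ.2.2.comp (ContDiff.contDiffOn (by fun_prop)) ?_) ?_
    · rintro _ ⟨q, hq, rfl⟩
      exact hball q hq
    · rintro _ ⟨q, hq, rfl⟩
      exact hΨU (Ψ.map_target (hball q hq))
  · have hs : ContDiffOn ℝ ∞ (fun p => (Φ (f p)).1) U :=
      (hΦ.2.1.comp (hf.smooth.mono hUO) fun p hp => hp.1.2.1).fst
    refine hs.comp (hΨ.2.2.comp (ContDiff.contDiffOn (by fun_prop)) ?_) ?_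
    · rintro _ ⟨q, hq, rfl⟩
      exact hq
    · rintro _ ⟨q, hq, rfl⟩
      exact hΨU (Ψ.map_target hq)
  · intro p hp
    have h1 := hindep _ (Ψ.map_source hp)
    rw [Ψ.left_inv hp] at h1
    refine ⟨h1, ?_⟩
    change _ = (Φ (f (Ψ.symm (Ψ p)))).1
    rw [Ψ.left_inv hp]
  · intro q hq
    have hp := Ψ.map_target hq
    have hpU' := hΨU hp
    set p := Ψ.symm q with hpdef
    let ι : (Fin (m - ρ) → ℝ) → ((Fin (n - d) → ℝ) × (Fin d → ℝ)) ×
        ((Fin (m - ρ) → ℝ) × (Fin ρ → ℝ)) := fun v => (q.1, (v, q.2.2))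
    have hιd : HasFDerivAt ι ((ContinuousLinearMap.inr ℝ _ _).comp
        (ContinuousLinearMap.inl ℝ _ _)) q.2.1 :=
      (hasFDerivAt_prodMk_right q.1 q.2).comp q.2.1 (hasFDerivAt_prodMk_left q.2.1 q.2.2)
    have h1 : HasFDerivAt (fun v => Ψ.symm (ι v)) _ q.2.1 :=
      (hΨ.hasFDerivAt_symm (y := ι q.2.1) hq).comp q.2.1 hιd
    have h2 : HasFDerivAt (fun p => Φ (f p)) ((fderiv ℝ Φ (f p)).comp (fderiv ℝ f p)) p :=
      (hΦ.hasFDerivAt hpU'.1.2.1).comp p (hf.differentiableAt (hUO hpU')).hasFDerivAt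
    have h3 : HasFDerivAt (fun v => (Φ (f (Ψ.symm (ι v)))).1) _ q.2.1 :=
      (HasFDerivAt.comp q.2.1 (f := fun v => Ψ.symm (ι v)) h2 h1).fst
    have h4 : Function.Surjective
        (fderiv ℝ (fun v => (Φ (f (Ψ.symm (ι v)))).1) q.2.1) := by
      -- Each vector w with dx̄₁(w) = b and dx̄₂(w) = 0 is attained by some u by `hlift`; such a u
      -- leaves ū₂ fixed, so its ū₁-component τ u already produces b.
      intro b
      let w := fderiv ℝ Φ.symm (Φ (f p)) (b, 0)
      have hw : fderiv ℝ Φ (f p) w = (b, 0) := hΦ.fderiv_fderiv_symm hpU'.1.2.1 _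
      obtain ⟨u, hu⟩ := hlift p hpU' w (congrArg Prod.snd hw)
      have hGu : fderiv ℝ Ψ p (0, u) = (0, (τ u, 0)) := by
        rw [hΨG, hGd p hpU', ← inputDeriv_apply, hu, map_zero]
        have : D (f p) w = 0 := congrArg Prod.snd hw
        rw [this, map_zero]
      have hΨu : fderiv ℝ Ψ.symm q (0, (τ u, 0)) = (0, u) := by
        rw [← hGu, ← Ψ.right_inv hq]
        exact hΨ.fderiv_symm_fderiv hp (0, u)
      refine ⟨τ u, ?_⟩
      rw [h3.fderiv]
      change (fderiv ℝ Φ (f p) (fderiv ℝ f p (fderiv ℝ Ψ.symm q (0, (τ u, 0))))).1 = b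
      rw [hΨu, ← inputDeriv_apply, hu, hw]
    change Module.finrank ℝ (LinearMap.range
      (fderiv ℝ (fun v => (Φ (f (Ψ.symm (ι v)))).1) q.2.1).toLinearMap) = n - d
    rw [LinearMap.range_eq_top.2 h4, finrank_top, Module.finrank_fin_fun]

end System

/-! ### Reduction to the state space and the main theorem -/

section System

variable {n m : ℕ} {f : (Fin n → ℝ) × (Fin m → ℝ) → (Fin n → ℝ)}
  {x₀ : Fin n → ℝ} {u₀ : Fin m → ℝ}

/-- Straightening out a codistribution on the `(x, u)`-space that only depends on `x` is a condition
on the `x`-space. -/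
theorem straightensOut_iff {V : Set (Fin n → ℝ)} (hV : IsOpen V) (hx : x₀ ∈ V)
    {N : (Fin n → ℝ) → Submodule ℝ ((Fin n → ℝ) →L[ℝ] ℝ)}
    {P : (Fin n → ℝ) × (Fin m → ℝ) → Submodule ℝ ((Fin n → ℝ) × (Fin m → ℝ) →L[ℝ] ℝ)}
    (hP : ∀ p, p.1 ∈ V → P p =
      (N p.1).map (pullForm (ContinuousLinearMap.fst ℝ (Fin n → ℝ) (Fin m → ℝ)))) {n₁ n₂ : ℕ}
    {Φ : OpenPartialHomeomorph (Fin n → ℝ) ((Fin n₁ → ℝ) × (Fin n₂ → ℝ))}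
    (hΦ : IsDiffeoAround Φ x₀) :
    StraightensOut Φ x₀ u₀ P ↔
      ∀ᶠ y in 𝓝 x₀, N y = LinearMap.range (pullForm (fderiv ℝ (fun y => (Φ y).2) y)) := by
  have key : ∀ p : (Fin n → ℝ) × (Fin m → ℝ), p.1 ∈ V ∩ Φ.source →
      (P p = dspan (fun q : (Fin n → ℝ) × (Fin m → ℝ) => (Φ q.1).2) p ↔
        N p.1 = LinearMap.range (pullForm (fderiv ℝ (fun y => (Φ y).2) p.1))) := by
    intro p hp
    have h1 : HasFDerivAt (fun q : (Fin n → ℝ) × (Fin m → ℝ) => (Φ q.1).2)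
        ((fderiv ℝ (fun y => (Φ y).2) p.1).comp (ContinuousLinearMap.fst ℝ _ _)) p :=
      (hΦ.hasFDerivAt hp.2).snd.differentiableAt.hasFDerivAt.comp p hasFDerivAt_fst
    have h2 : dspan (fun q : (Fin n → ℝ) × (Fin m → ℝ) => (Φ q.1).2) p =
        (LinearMap.range (pullForm (fderiv ℝ (fun y => (Φ y).2) p.1))).map
          (pullForm (ContinuousLinearMap.fst ℝ (Fin n → ℝ) (Fin m → ℝ))) := by
      rw [dspan_eq_range h1.differentiableAt, h1.fderiv, ← LinearMap.range_comp]
      rfl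
    rw [hP p hp.1, h2]
    exact (Submodule.map_injective_of_injective
      (pullForm_injective Prod.fst_surjective)).eq_iff
  have hmem : ∀ᶠ y in 𝓝 x₀, y ∈ V ∩ Φ.source :=
    (hV.inter Φ.open_source).eventually_mem ⟨hx, hΦ.1⟩
  constructor
  · rintro ⟨-, h⟩
    have h1 : Filter.Tendsto (fun y => (y, u₀)) (𝓝 x₀) (𝓝 (x₀, u₀)) :=
      (Continuous.prodMk_left u₀).tendsto x₀
    filter_upwards [h1.eventually h, hmem] with y hy hyV
    exact (key (y, u₀) hyV).1 hy
  · intro h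
    refine ⟨hΦ, ?_⟩
    have h1 : Filter.Tendsto Prod.fst (𝓝 (x₀, u₀)) (𝓝 x₀) := continuous_fst.tendsto (x₀, u₀)
    filter_upwards [h1.eventually h, h1.eventually hmem] with p hp hpV
    exact (key p hpV).2 hp

end System

theorem mainTheorem2 (n m : ℕ) (f : (Fin n → ℝ) × (Fin m → ℝ) → (Fin n → ℝ))
    (O : Set ((Fin n → ℝ) × (Fin m → ℝ))) (x₀ : Fin n → ℝ) (u₀ : Fin m → ℝ)
    (hf : IsSystemAround f O x₀ u₀)
    (hcap : ∃ d, IsCodistributionOn O d (P1 n m ⊓ dspan f))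
    (hplus : ∃ d, IsCodistributionOn O d (P2plus f O)) :
    (∃ W P₂, IsP2 f O x₀ u₀ W P₂) ∧
    ∀ W P₂, IsP2 f O x₀ u₀ W P₂ →
      ∃ d₁ d₂ : ℕ,
        IsCodistributionOn (shiftDomain f W) d₁ (P1 n m) ∧
        IsCodistributionOn (shiftDomain f W) d₂ P₂ ∧
        (HasTriangularForm f O x₀ u₀ ↔ d₂ < d₁) ∧
        (d₂ < d₁ →
          (∃ Φ : OpenPartialHomeomorph (Fin n → ℝ) ((Fin (d₁ - d₂) → ℝ) × (Fin d₂ → ℝ)),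
            StraightensOut Φ x₀ u₀ P₂) ∧
          ∀ Φ : OpenPartialHomeomorph (Fin n → ℝ) ((Fin (d₁ - d₂) → ℝ) × (Fin d₂ → ℝ)),
            StraightensOut Φ x₀ u₀ P₂ →
            ∃ (m₁ m₂ : ℕ)
              (Ψ : OpenPartialHomeomorph ((Fin n → ℝ) × (Fin m → ℝ))
                (((Fin (d₁ - d₂) → ℝ) × (Fin d₂ → ℝ)) × ((Fin m₁ → ℝ) × (Fin m₂ → ℝ)))),
              IsTriangularForm f O x₀ u₀ Φ Ψ) := by
  obtain ⟨c, hcap⟩ := hcap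
  obtain ⟨d, hplus⟩ := hplus
  obtain ⟨r, hr⟩ := hf.exists_rank hcap
  refine ⟨hf.exists_P2 hplus, fun W P₂ hP₂ => ?_⟩
  obtain ⟨N, hN, hPN, hcod⟩ := hP₂.exists_shiftField hf hplus
  have hpW : (x₀, u₀) ∈ W := hP₂.2.1
  have hV : IsOpen (f '' W) := hf.isOpen_image hN.isOpen hN.subset
  have hxV : x₀ ∈ f '' W := ⟨_, hpW, hf.equilibrium⟩
  obtain ⟨Φ, hΦ, hΦst⟩ := hN.exists_straightening hf hr hpW
  have hcompl := fun (hd : d < n)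
      (Φ : OpenPartialHomeomorph (Fin n → ℝ) ((Fin (n - d) → ℝ) × (Fin d → ℝ)))
      (h : StraightensOut Φ x₀ u₀ P₂) =>
    hN.exists_completion hf hr hpW hd h.1 ((straightensOut_iff hV hxV hPN h.1).1 h)
  have hΦ' : StraightensOut Φ x₀ u₀ P₂ := (straightensOut_iff hV hxV hPN hΦ).2 hΦst
  -- The shift preserves dimension because df is onto, so dim P₂ = dim P₂⁺ = d for every W.
  refine ⟨n, d, isCodistributionOn_P1 (hV.preimage continuous_fst), hcod, ⟨?_, fun hd => ?_⟩,
    fun hd => ⟨⟨Φ, hΦ'⟩, hcompl hd⟩⟩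
  · rintro ⟨n₁, n₂, m₁, m₂, Φ, Ψ, h⟩
    have := h.finrank_lt hf
    rwa [hplus.finrank_eq hf.mem] at this
  · obtain ⟨m₁, m₂, Ψ, h⟩ := hcompl hd Φ hΦ'
    exact ⟨_, _, m₁, m₂, Φ, Ψ, h⟩
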